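/- **Setting.** Profits lie in $[0,1]$, efforts in $[0,\bar e]$ with $\bar e>0$. For each $e\in[0,\bar e]$, $\phi(\cdot|e)$ is a probability density on $[0,1]$ with $\phi(x|e)>0$ for all $x\in[0,1]$; it is differentiable in $e$ with derivative $\phi_e(x|e)$ (one-sided at the endpoints), and $|\phi_e(x|e)|\le g(x)$ for all $x,e$, for some $g$ integrable on $[0,1]$. The effort cost $C\ge 0$ is differentiable on $[0,\bar e]$; $I>0$ and $r>0$. A *security* is a nondecreasing right-continuous $H:[0,1]\to\mathbb{R}$ with $0\le H(x)\le x$. Let $$U(H,e)=\int_0^1 (x-H(x))\phi(x|e)\,dx-C(e).$$ The *entrepreneur's problem* is to maximize $U(H,e)$ over securities $H$ and efforts $e\in[0,\bar e]$ subject to $$\int_0^1 (x-H(x))\phi_e(x|e)\,dx=C'(e)\quad(\mathrm{FOC}),\qquad \int_0^1 H(x)\phi(x|e)\,dx\ge(1+r)I\quad(\mathrm{IR}).$$ A security *solves* the problem if it attains the maximum together with some effort. A security $H$ is a *contingent debt contract* with $k$ face values if there are $k$ nonempty intervals $[\underline x_n,\overline x_n)$ with $\underline x_n\in[0,1]$ such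 that $H$ is constant on $[\underline x_n,\overline x_n)\cap[0,1]$, $H(x)=x$ for $x\in[0,1]$ outside their union, and the face values $d_n=H(\underline x_n)$ are pairwise distinct. The face value $d_n$ is *non-defaultable* if $d_n<x$ for all $x\in[\underline x_n,\overline x_n)\cap[0,1]$. A function on $[0,1]$ is *$n$-peaked* if there are $n$ disjoint intervals in $[0,1]$ on each of which it is nondecreasing while it is nonincreasing on each interval contained in the complement of their union; it is *at most $N$-peaked* if it is $n$-peaked for some $n\le N$. **Proposition 4.** Suppose that, for every $e\in[0,\bar e]$, $(1+r)I$ lies in the interior of $$\Big\{\int_0^1 H(x)\phi(x|e)\,dx \;:\; H \text{ a security},\ \int_0^1 (x-H(x))\phi_e(x|e)\,dx=C'(e)\Big\}.$$ 1. If $N\in\mathbb{N}$ is such that $\phi_e(\cdot|e)/\phi(\cdot|e)$ is at most $N$-peaked for every $e\in[0,\bar e]$, then some contingent debt contract with at most $N+1$ face values, at most two of them non-defaultable, solves the entrepreneur's problem. 2. If the densities satisfy the monotone likelihood ratio property ($\phi(x|e')/\phi(x|e)$ is nondecreasing in $x\in[0,1]$ whenever $e\le e'$), then there is $d>0$ such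 that the standard debt contract $H^d(x)=\min\{x,d\}$ solves the entrepreneur's problem in which (FOC) is replaced by $e\in\arg\max_{t\in[0,\bar e]}U(H,t)$. If in addition, for every security $H$, every maximizer of $U(H,\cdot)$ on $[0,\bar e]$ satisfies (FOC), then $H^d$ also solves the entrepreneur's problem with (FOC). -/

import Mathlib

open Set MeasureTheory

noncomputable section

namespace SecurityDesign

/-- A security on profits in `[0,1]`: nondecreasing, right-continuous, and between `0` and the
profit. Values of `H` outside `[0,1]` are irrelevant. -/
structure IsSecurity (H : ℝ → ℝ) : Prop where
  mono : MonotoneOn H (Icc 0 1)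
  rightCont : ∀ x ∈ Ico (0 : ℝ) 1, ContinuousWithinAt H (Ici x) x
  nonneg : ∀ x ∈ Icc (0 : ℝ) 1, 0 ≤ H x
  le_self : ∀ x ∈ Icc (0 : ℝ) 1, H x ≤ x

/-- The moral hazard environment. `density x e` is the density of the profit `x ∈ [0,1]` under
effort `e ∈ [0, maxEffort]`, `densityDeriv` its derivative in `e`, `cost` the effort cost and
`costDeriv` its derivative (one-sided at the two ends of the effort interval). -/
structure Model where
  maxEffort : ℝ
  density : ℝ → ℝ → ℝ
  densityDeriv : ℝ → ℝ → ℝ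
  cost : ℝ → ℝ
  costDeriv : ℝ → ℝ
  investment : ℝ
  rate : ℝ
  maxEffort_pos : 0 < maxEffort
  investment_pos : 0 < investment
  rate_pos : 0 < rate
  density_pos : ∀ x ∈ Icc (0 : ℝ) 1, ∀ e ∈ Icc 0 maxEffort, 0 < density x e
  density_integrable : ∀ e ∈ Icc 0 maxEffort,
    IntegrableOn (fun x => density x e) (Icc 0 1) volume
  density_integral : ∀ e ∈ Icc 0 maxEffort, ∫ x in (0 : ℝ)..1, density x e = 1
  density_hasDeriv : ∀ x ∈ Icc (0 : ℝ) 1, ∀ e ∈ Icc 0 maxEffort,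
    HasDerivWithinAt (fun t => density x t) (densityDeriv x e) (Icc 0 maxEffort) e
  densityDeriv_dominated : ∃ g : ℝ → ℝ, IntegrableOn g (Icc 0 1) volume ∧
    ∀ x ∈ Icc (0 : ℝ) 1, ∀ e ∈ Icc 0 maxEffort, |densityDeriv x e| ≤ g x
  cost_nonneg : ∀ e ∈ Icc 0 maxEffort, 0 ≤ cost e
  cost_hasDeriv : ∀ e ∈ Icc 0 maxEffort,
    HasDerivWithinAt cost (costDeriv e) (Icc 0 maxEffort) e

namespace Model

variable (M : Model)

/-- The return `(1 + r) I` required by the investor. -/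
def requiredReturn : ℝ := (1 + M.rate) * M.investment

/-- The investor's expected return from the security `H` under effort `e`. -/
def investorReturn (H : ℝ → ℝ) (e : ℝ) : ℝ := ∫ x in (0 : ℝ)..1, H x * M.density x e

/-- The entrepreneur's expected payoff. -/
def payoff (H : ℝ → ℝ) (e : ℝ) : ℝ :=
  (∫ x in (0 : ℝ)..1, (x - H x) * M.density x e) - M.cost e

/-- The first-order condition of the entrepreneur's effort choice. -/
def FirstOrder (H : ℝ → ℝ) (e : ℝ) : Prop :=
  ∫ x in (0 : ℝ)..1, (x - H x) * M.densityDeriv x e = M.costDeriv e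

/-- Given the security `H`, the effort `e` maximizes the entrepreneur's payoff over
`[0, maxEffort]`. -/
def BestResponse (H : ℝ → ℝ) (e : ℝ) : Prop :=
  e ∈ Icc 0 M.maxEffort ∧ ∀ t ∈ Icc 0 M.maxEffort, M.payoff H t ≤ M.payoff H e

/-- Every solution of the effort problem, for any security, satisfies the first-order condition. -/
def FirstOrderNecessary : Prop :=
  ∀ H e, IsSecurity H → M.BestResponse H e → M.FirstOrder H e

/-- Feasibility of a security and an effort when incentive compatibility means `IC`. -/
structure Feasible (IC : (ℝ → ℝ) → ℝ → Prop) (H : ℝ → ℝ) (e : ℝ) : Prop where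
  security : IsSecurity H
  effort_mem : e ∈ Icc 0 M.maxEffort
  incentive : IC H e
  participation : M.requiredReturn ≤ M.investorReturn H e

/-- `(H, e)` maximizes the entrepreneur's payoff among the feasible pairs. -/
def Optimal (IC : (ℝ → ℝ) → ℝ → Prop) (H : ℝ → ℝ) (e : ℝ) : Prop :=
  M.Feasible IC H e ∧ ∀ G t, M.Feasible IC G t → M.payoff G t ≤ M.payoff H e

/-- The security `H`, with some effort, solves the entrepreneur's problem whose incentive
constraint is the first-order condition. -/
def SolvesProblem (H : ℝ → ℝ) : Prop := ∃ e, M.Optimal M.FirstOrder H e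

/-- The security `H`, with some effort, solves the entrepreneur's problem whose incentive
constraint is that the effort is a best response to the security. -/
def SolvesBestResponseProblem (H : ℝ → ℝ) : Prop := ∃ e, M.Optimal M.BestResponse H e

/-- For every effort `e`, the required return is interior to the set of the expected returns of
the securities that satisfy the first-order condition at `e`. -/
def RequiredReturnInterior : Prop :=
  ∀ e ∈ Icc 0 M.maxEffort, M.requiredReturn ∈
    interior {y : ℝ | ∃ H, IsSecurity H ∧ M.FirstOrder H e ∧ M.investorReturn H e = y}

/-- The monotone likelihood ratio property. -/
def MLRP : Prop :=
  ∀ e ∈ Icc 0 M.maxEffort, ∀ t ∈ Icc 0 M.maxEffort, e ≤ t →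
    MonotoneOn (fun x => M.density x t / M.density x e) (Icc 0 1)

end Model

/-- `ρ` is `n`-peaked on `[0,1]`: there are `n` disjoint intervals on each of which `ρ` is
increasing, and `ρ` is decreasing on each interval of the complement of their union. -/
def IsPeaked (n : ℕ) (ρ : ℝ → ℝ) : Prop :=
  ∃ I : Fin n → Set ℝ, (∀ k, (I k).OrdConnected) ∧ (∀ k, I k ⊆ Icc 0 1) ∧
    Pairwise (fun j k => Disjoint (I j) (I k)) ∧ (∀ k, MonotoneOn ρ (I k)) ∧
    ∀ J : Set ℝ, J.OrdConnected → J ⊆ Icc 0 1 \ ⋃ k, I k → AntitoneOn ρ J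

/-- `ρ` is at most `N`-peaked. -/
def IsAtMostPeaked (N : ℕ) (ρ : ℝ → ℝ) : Prop := ∃ n ≤ N, IsPeaked n ρ

/-- `H` is a contingent debt contract with the intervals `[lo n, hi n)`, read inside `[0,1]`, and
the pairwise distinct face values `H (lo n)`. The number of face values is the size of `ι`. -/
structure IsContingentDebt {ι : Type} [Countable ι] (H : ℝ → ℝ) (lo hi : ι → ℝ) : Prop where
  security : IsSecurity H
  lo_mem : ∀ n, lo n ∈ Icc (0 : ℝ) 1
  lo_lt_hi : ∀ n, lo n < hi n
  const : ∀ n, ∀ x ∈ Ico (lo n) (hi n) ∩ Icc 0 1, H x = H (lo n)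
  eq_self : ∀ x ∈ Icc (0 : ℝ) 1, (∀ n, x ∉ Ico (lo n) (hi n)) → H x = x
  distinct : Function.Injective (fun n => H (lo n))

/-- The `n`-th face value is below every profit at which it is in effect. -/
def NonDefaultable {ι : Type} (H : ℝ → ℝ) (lo hi : ι → ℝ) (n : ι) : Prop :=
  ∀ x ∈ Ico (lo n) (hi n) ∩ Icc 0 1, H (lo n) < x

/-- Standard debt with face value `d`. -/
def standardDebt (d : ℝ) : ℝ → ℝ := fun x => min x d

end SecurityDesign

end

namespace SecurityDesign

/-! The entrepreneur's payoff is the surplus `M.surplus e`, which does not depend on the security,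
minus the investor's return. So a feasible pair that maximizes the surplus and leaves the investor
exactly `M.requiredReturn` is optimal (`optimal_of_isMaxOn`), and the task is to find a security of
the right shape with prescribed integrals at one effort.

Contingent debt. Let φ be the density and ψ its effort derivative at a surplus maximizer; the
hypothesis on the required return supplies a security G with the right integrals against both. Where
ψ/φ decreases, a capped payment with the φ-mean of G has a larger ψ-integral than G; where ψ/φ
increases, a jump from a low to a high cap does. Both follow from one single-crossing inequality
(`integral_mul_nonneg_of_crossing`). Gluing the pieces gives a stair with the φ-mean of G and a
larger ψ-integral (`exists_stair_ge`); applied to -ψ, it gives one with a smaller ψ-integral.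
Connectedness yields a stair with both integrals of G (`exists_stair_eq`). Finally, the payment is
affine in the caps that are not tied to the profit, while only two integrals must be kept, so an
extreme-point argument leaves at most two such caps (`exists_stair_ncard_looseFaces_le`).

Standard debt. Choose d so that debt returns the required amount at the top effort. Under the
monotone likelihood ratio its return rises with effort, so at lower efforts it is at most the
required one. At an interior effort, take a security K that satisfies the first-order condition with
the required return. K minus debt has nonnegative mean and crosses it once from below, so debt gives
the entrepreneur at least the marginal payoff that K gives, which is zero. Hence the payoff from
debt and the return of debt are both largest at the top effort, and so is their sum, the surplus. -/

/-! ### Integrability and the single-crossing inequality -/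

theorem integrableOn_mul_of_monotoneOn {f w : ℝ → ℝ} (hf : MonotoneOn f (Icc 0 1))
    (hw : IntegrableOn w (Icc 0 1)) : IntegrableOn (fun x => f x * w x) (Icc 0 1) := by
  have hm : AEStronglyMeasurable f (volume.restrict (Icc 0 1)) :=
    (aemeasurable_restrict_of_monotoneOn measurableSet_Icc hf).aestronglyMeasurable
  refine Integrable.bdd_mul (c := |f 0| + |f 1|) hw hm ?_
  filter_upwards [ae_restrict_mem measurableSet_Icc] with x hx
  have h0 := hf (left_mem_Icc.2 zero_le_one) hx hx.1
  have h1 := hf hx (right_mem_Icc.2 zero_le_one) hx.2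
  rw [Real.norm_eq_abs, abs_le]
  constructor
  · linarith [neg_abs_le (f 0), abs_nonneg (f 1)]
  · linarith [le_abs_self (f 1), abs_nonneg (f 0)]

theorem intervalIntegrable_sub {w : ℝ → ℝ} (hw : IntegrableOn w (Icc 0 1)) {a b : ℝ}
    (ha : a ∈ Icc (0 : ℝ) 1) (hb : b ∈ Icc (0 : ℝ) 1) : IntervalIntegrable w volume a b :=
  (hw.mono_set (uIcc_subset_Icc ha hb)).intervalIntegrable

theorem IsSecurity.integrableOn_mul {H w : ℝ → ℝ} (hH : IsSecurity H)
    (hw : IntegrableOn w (Icc 0 1)) : IntegrableOn (fun x => H x * w x) (Icc 0 1) :=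
  integrableOn_mul_of_monotoneOn hH.mono hw

/-- A function that crosses zero once from below and has zero mean correlates nonnegatively with
an increasing ratio of densities. -/
theorem integral_mul_nonneg_of_crossing {a b t : ℝ} (hab : a ≤ b) {D φ ψ : ℝ → ℝ}
    (hφ : ∀ x ∈ Ioo a b, 0 < φ x) (hρ : MonotoneOn (fun x => ψ x / φ x) (Ioo a b))
    (hneg : ∀ x ∈ Ioo a b, x < t → D x ≤ 0) (hpos : ∀ x ∈ Ioo a b, t < x → 0 ≤ D x)
    (hDφ : IntervalIntegrable (fun x => D x * φ x) volume a b)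
    (hDψ : IntervalIntegrable (fun x => D x * ψ x) volume a b)
    (h0 : ∫ x in a..b, D x * φ x = 0) : 0 ≤ ∫ x in a..b, D x * ψ x := by
  by_cases ht : t ∈ Ioo a b
  -- Subtracting a multiple of the zero mean centers the ratio at its value at `t`; then both
  -- factors of the integrand change sign at `t`.
  · have key : ∫ x in a..b, D x * ψ x
        = ∫ x in a..b, (D x * ψ x - (ψ t / φ t) * (D x * φ x)) := by
      rw [intervalIntegral.integral_sub hDψ (hDφ.const_mul _),
        intervalIntegral.integral_const_mul, h0, mul_zero, sub_zero]
    rw [key, intervalIntegral.integral_of_le hab, integral_Ioc_eq_integral_Ioo]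
    refine setIntegral_nonneg measurableSet_Ioo fun x hx => ?_
    have hx0 := hφ x hx
    have e : D x * ψ x - (ψ t / φ t) * (D x * φ x) = D x * (ψ x / φ x - ψ t / φ t) * φ x := by
      rw [mul_sub, sub_mul, mul_assoc, div_mul_cancel₀ _ hx0.ne']; ring
    rw [e]
    refine mul_nonneg ?_ hx0.le
    rcases lt_trichotomy x t with h | h | h
    · exact mul_nonneg_of_nonpos_of_nonpos (hneg x hx h) (sub_nonpos.2 (hρ hx ht h.le))
    · simp [h]
    · exact mul_nonneg (hpos x hx h) (sub_nonneg.2 (hρ ht hx h.le))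
  -- With no crossing inside the interval, `D` has one sign, and its zero mean makes it vanish
  -- almost everywhere.
  · have hz : ∀ᵐ x ∂volume.restrict (Ioo a b), D x = 0 := by
      rw [intervalIntegral.integral_of_le hab, integral_Ioc_eq_integral_Ioo] at h0
      have hi : IntegrableOn (fun x => D x * φ x) (Ioo a b) :=
        ((intervalIntegrable_iff_integrableOn_Ioo_of_le hab).1 hDφ)
      rw [mem_Ioo, not_and_or, not_lt, not_lt] at ht
      rcases ht with ht | ht
      · have h1 := (setIntegral_eq_zero_iff_of_nonneg_ae (f := fun x => D x * φ x)
          (by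
            filter_upwards [ae_restrict_mem measurableSet_Ioo] with x hx
            exact mul_nonneg (hpos x hx (ht.trans_lt hx.1)) (hφ x hx).le) hi).1 h0
        filter_upwards [h1, ae_restrict_mem measurableSet_Ioo] with x hx hm
        exact (mul_eq_zero.1 hx).resolve_right (hφ x hm).ne'
      · have h1 := (setIntegral_eq_zero_iff_of_nonneg_ae (f := fun x => -(D x * φ x))
          (by
            filter_upwards [ae_restrict_mem measurableSet_Ioo] with x hx
            exact neg_nonneg.2 (mul_nonpos_of_nonpos_of_nonneg
              (hneg x hx (hx.2.trans_le ht)) (hφ x hx).le)) hi.neg).1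
              (by rw [integral_neg, h0, neg_zero])
        filter_upwards [h1, ae_restrict_mem measurableSet_Ioo] with x hx hm
        exact (mul_eq_zero.1 (neg_eq_zero.1 hx)).resolve_right (hφ x hm).ne'
    rw [intervalIntegral.integral_of_le hab, integral_Ioc_eq_integral_Ioo]
    refine integral_nonneg_of_ae ?_
    filter_upwards [hz] with x hx
    simp [hx]

/-! ### Stairs: securities with finitely many caps -/

/-- The level in effect at `x`: `m i` on `[s i, s (i + 1))` for `i < n`, and `m n` from `s n`. -/
noncomputable def level (s m : ℕ → ℝ) : ℕ → ℝ → ℝ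
  | 0, _ => m 0
  | n + 1, x => if s (n + 1) ≤ x then m (n + 1) else level s m n x

/-- The security that pays `min x (m i)` on `[s i, s (i + 1))`, with `n + 1` caps followed by a
last regime. -/
noncomputable def stair (n : ℕ) (s m : ℕ → ℝ) (x : ℝ) : ℝ := min x (level s m (n + 1) x)

/-- Admissible parameters of `stair`; in the last regime the cap does not bind. -/
structure Steps (n : ℕ) (s m : ℕ → ℝ) : Prop where
  mono_s : Monotone s
  zero_s : s 0 = 0
  mono_m : Monotone m
  nonneg : 0 ≤ m 0
  last : ∀ i, n < i → m i = 1

theorem level_eq {s m : ℕ → ℝ} (hs : Monotone s) {n i : ℕ} {x : ℝ} (hi : i ≤ n)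
    (h1 : s i ≤ x) (h2 : i = n ∨ x < s (i + 1)) : level s m n x = m i := by
  induction n with
  | zero => obtain rfl : i = 0 := by omega
            rfl
  | succ n ih =>
    rcases hi.eq_or_lt with rfl | hlt
    · simp [level, h1]
    · have hx : x < s (i + 1) := h2.resolve_left (by omega)
      have : ¬ s (n + 1) ≤ x := not_le.2 (hx.trans_le (hs (by omega)))
      simp only [level, this, if_false]
      exact ih (by omega) (Or.inr hx)

theorem exists_level_eq {s m : ℕ → ℝ} (h0 : s 0 = 0) (n : ℕ) {x : ℝ} (hx : 0 ≤ x) :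
    ∃ i ≤ n, s i ≤ x ∧ (i = n ∨ x < s (i + 1)) ∧ level s m n x = m i := by
  induction n with
  | zero => exact ⟨0, le_rfl, h0 ▸ hx, Or.inl rfl, rfl⟩
  | succ n ih =>
    by_cases h : s (n + 1) ≤ x
    · exact ⟨n + 1, le_rfl, h, Or.inl rfl, by simp [level, h]⟩
    · obtain ⟨i, hi, h1, h2, h3⟩ := ih
      refine ⟨i, by omega, h1, Or.inr ?_, by simp [level, h, h3]⟩
      rcases h2 with rfl | h2
      · exact not_le.1 h
      · exact h2

theorem level_le {s m : ℕ → ℝ} (hm : Monotone m) (n : ℕ) (x : ℝ) : level s m n x ≤ m n := by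
  induction n with
  | zero => exact le_rfl
  | succ n ih =>
    by_cases h : s (n + 1) ≤ x
    · simp [level, h]
    · simpa [level, h] using ih.trans (hm n.le_succ)

theorem level_nonneg {s m : ℕ → ℝ} (hm : ∀ i, 0 ≤ m i) (n : ℕ) (x : ℝ) : 0 ≤ level s m n x := by
  induction n with
  | zero => exact hm 0
  | succ n ih =>
    by_cases h : s (n + 1) ≤ x
    · simpa [level, h] using hm _
    · simpa [level, h] using ih

theorem level_mono {s m s' m' : ℕ → ℝ} (hm : Monotone m) (hss : ∀ i, s' i ≤ s i)
    (hmm : ∀ i, m i ≤ m' i) (n : ℕ) {x y : ℝ} (hxy : x ≤ y) :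
    level s m n x ≤ level s' m' n y := by
  induction n with
  | zero => exact hmm 0
  | succ n ih =>
    by_cases h : s (n + 1) ≤ x
    · have h' : s' (n + 1) ≤ y := (hss _).trans (h.trans hxy)
      simpa [level, h, h'] using hmm _
    · by_cases h' : s' (n + 1) ≤ y
      · simpa [level, h, h'] using ((level_le hm n x).trans (hm n.le_succ)).trans (hmm _)
      · simpa [level, h, h'] using ih

theorem level_comp (s m : ℕ → ℝ) (f : ℝ → ℝ) (n : ℕ) (x : ℝ) :
    level s (fun i => f (m i)) n x = f (level s m n x) := by
  induction n with
  | zero => rfl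
  | succ n ih => by_cases h : s (n + 1) ≤ x <;> simp [level, h, ih]

theorem level_continuousWithinAt (s m : ℕ → ℝ) (n : ℕ) (x : ℝ) :
    ContinuousWithinAt (level s m n) (Ici x) x := by
  induction n with
  | zero => exact continuousWithinAt_const
  | succ n ih =>
    by_cases h : s (n + 1) ≤ x
    · refine (continuousWithinAt_const (b := m (n + 1))).congr (fun y hy => ?_) ?_
      · simp [level, h.trans hy]
      · simp [level, h]
    · refine ih.congr_of_eventuallyEq ?_ (by simp [level, h])
      filter_upwards [mem_nhdsWithin_of_mem_nhds (Iio_mem_nhds (not_le.1 h))] with y hy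
      simp [level, not_le.2 (mem_Iio.1 hy)]

theorem measurable_level (s m : ℕ → ℝ) (n : ℕ) : Measurable (level s m n) := by
  induction n with
  | zero => exact measurable_const
  | succ n ih => exact Measurable.ite measurableSet_Ici measurable_const ih

theorem measurable_stair (n : ℕ) (s m : ℕ → ℝ) : Measurable (stair n s m) :=
  measurable_id.min (measurable_level s m _)

namespace Steps

variable {n : ℕ} {s m : ℕ → ℝ}

theorem m_nonneg (h : Steps n s m) (i : ℕ) : 0 ≤ m i := h.nonneg.trans (h.mono_m (Nat.zero_le _))

theorem m_le_one (h : Steps n s m) (i : ℕ) : m i ≤ 1 :=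
  (h.mono_m (by omega : i ≤ n + 1 + i)).trans (h.last _ (by omega)).le

theorem isSecurity (h : Steps n s m) : IsSecurity (stair n s m) where
  mono _ _ _ _ hxy := min_le_min hxy (level_mono h.mono_m (fun _ => le_rfl) (fun _ => le_rfl) _ hxy)
  rightCont _ _ := continuousWithinAt_id.min (level_continuousWithinAt s m _ _)
  nonneg x hx := le_min hx.1 (level_nonneg h.m_nonneg _ x)
  le_self _ _ := min_le_left _ _

theorem stair_eq (h : Steps n s m) {i : ℕ} {x : ℝ} (hi : i ≤ n + 1) (h1 : s i ≤ x)
    (h2 : i = n + 1 ∨ x < s (i + 1)) : stair n s m x = min x (m i) := by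
  rw [stair, level_eq h.mono_s hi h1 h2]

theorem mono {s' m' : ℕ → ℝ} (h : Steps n s m) (hs : ∀ i, s' i ≤ s i) (hm : ∀ i, m i ≤ m' i)
    (x : ℝ) : stair n s m x ≤ stair n s' m' x :=
  min_le_min le_rfl (level_mono h.mono_m hs hm _ le_rfl)

end Steps

/-- Weighted integrals of `stair` depend continuously on the parameters. -/
theorem continuous_integral_stair {X : Type*} [TopologicalSpace X] [FirstCountableTopology X]
    {s m : X → ℕ → ℝ} (hs : ∀ i, Continuous fun p => s p i) (hm : ∀ i, Continuous fun p => m p i)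
    (h0 : ∀ p i, 0 ≤ m p i) (n : ℕ) {w : ℝ → ℝ} (hw : IntegrableOn w (Icc 0 1)) :
    Continuous fun p => ∫ x in (0 : ℝ)..1, stair n (s p) (m p) x * w x := by
  have hwi : IntegrableOn w (Ioc 0 1) := hw.mono_set Ioc_subset_Icc_self
  simp only [intervalIntegral.integral_of_le (zero_le_one' ℝ)]
  refine continuous_iff_continuousAt.2 fun p => ?_
  refine continuousAt_of_dominated (bound := fun x => |w x|) ?_ ?_ hwi.abs ?_
  · exact Filter.Eventually.of_forall fun q =>
      (measurable_stair _ _ _).aestronglyMeasurable.mul hwi.aestronglyMeasurable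
  · refine Filter.Eventually.of_forall fun q => ?_
    filter_upwards [ae_restrict_mem measurableSet_Ioc] with x hx
    have h1 : 0 ≤ stair n (s q) (m q) x := le_min hx.1.le (level_nonneg (h0 q) _ x)
    have h2 : stair n (s q) (m q) x ≤ 1 := (min_le_left _ _).trans hx.2
    rw [norm_mul, Real.norm_eq_abs, Real.norm_eq_abs, abs_of_nonneg h1]
    exact mul_le_of_le_one_left (abs_nonneg _) h2
  -- Away from the countably many break points, the regime containing `x` does not change under
  -- small changes of the parameters.
  · have hnull : ∀ᵐ x ∂volume.restrict (Ioc (0 : ℝ) 1), ∀ i, x ≠ s p i :=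
      ae_restrict_of_ae (ae_all_iff.2 fun i => Measure.ae_ne volume (s p i))
    filter_upwards [hnull] with x hx
    have hl : ∀ k, ContinuousAt (fun q => level (s q) (m q) k x) p := by
      intro k
      induction k with
      | zero => exact (hm 0).continuousAt
      | succ k ih =>
        rcases (hx (k + 1)).lt_or_gt with h | h
        · refine ih.congr ?_
          filter_upwards [(hs (k + 1)).continuousAt.eventually (lt_mem_nhds h)] with q hq
          simp [level, not_le.2 hq]
        · refine ((hm (k + 1)).continuousAt).congr ?_
          filter_upwards [(hs (k + 1)).continuousAt.eventually (gt_mem_nhds h)] with q hq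
          simp [level, hq.le]
    exact (continuousAt_const.min (hl _)).mul continuousAt_const

/-! ### Replacing a security on one interval: caps and jumps -/

theorem integral_le_integral_of_le_Ioo {a b : ℝ} (hab : a ≤ b) {f g φ : ℝ → ℝ}
    (hφ : ∀ x ∈ Ioo a b, 0 ≤ φ x) (hle : ∀ x ∈ Ioo a b, f x ≤ g x)
    (hf : IntervalIntegrable (fun x => f x * φ x) volume a b)
    (hg : IntervalIntegrable (fun x => g x * φ x) volume a b) :
    ∫ x in a..b, f x * φ x ≤ ∫ x in a..b, g x * φ x :=
  intervalIntegral.integral_mono_on_of_le_Ioo hab hf hg fun x hx =>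
    mul_le_mul_of_nonneg_right (hle x hx) (hφ x hx)

theorem integral_eq_of_eqOn_Ioo {a b : ℝ} (hab : a ≤ b) {f g : ℝ → ℝ}
    (h : ∀ x ∈ Ioo a b, f x = g x) : ∫ x in a..b, f x = ∫ x in a..b, g x := by
  rw [intervalIntegral.integral_of_le hab, intervalIntegral.integral_of_le hab,
    integral_Ioc_eq_integral_Ioo, integral_Ioc_eq_integral_Ioo]
  exact setIntegral_congr_fun measurableSet_Ioo h

theorem monotone_min_const (c : ℝ) : Monotone fun x : ℝ => min x c := fun _ _ h =>
  min_le_min_right c h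

theorem integrableOn_min_mul {w : ℝ → ℝ} (hw : IntegrableOn w (Icc 0 1)) (c : ℝ) :
    IntegrableOn (fun x => min x c * w x) (Icc 0 1) :=
  integrableOn_mul_of_monotoneOn ((monotone_min_const c).monotoneOn _) hw

theorem continuous_integral_min_mul {w : ℝ → ℝ} (hw : IntegrableOn w (Icc 0 1)) {a b : ℝ}
    (ha : a ∈ Icc (0 : ℝ) 1) (hb : b ∈ Icc (0 : ℝ) 1) (hab : a ≤ b) :
    Continuous fun c : ℝ => ∫ x in a..b, min x c * w x := by
  have hwi : IntegrableOn w (Ioc a b) :=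
    hw.mono_set (Ioc_subset_Icc_self.trans (Icc_subset_Icc ha.1 hb.2))
  simp only [intervalIntegral.integral_of_le hab]
  refine continuous_iff_continuousAt.2 fun p => ?_
  refine continuousAt_of_dominated (bound := fun x => (1 + (|p| + 1)) * |w x|) ?_ ?_
    (hwi.abs.const_mul _) ?_
  · exact Filter.Eventually.of_forall fun q =>
      (measurable_id.min measurable_const).aestronglyMeasurable.mul hwi.aestronglyMeasurable
  · filter_upwards [Metric.ball_mem_nhds p one_pos] with q hq
    filter_upwards [ae_restrict_mem measurableSet_Ioc] with x hx
    rw [norm_mul, Real.norm_eq_abs, Real.norm_eq_abs]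
    refine mul_le_mul_of_nonneg_right ?_ (abs_nonneg _)
    have h1 : |q - p| < 1 := by simpa [Real.dist_eq] using hq
    have h2 : |q| ≤ |p| + 1 := by
      have := abs_sub_abs_le_abs_sub q p
      linarith
    have h3 : |x| ≤ 1 := abs_le.2 ⟨by linarith [ha.1, hx.1], hx.2.trans hb.2⟩
    have h4 : |min x q| ≤ |x| ⊔ |q| := abs_min_le_max_abs_abs
    have h5 : |x| ⊔ |q| ≤ 1 + (|p| + 1) := max_le (by linarith [abs_nonneg p]) (by linarith)
    exact h4.trans h5
  · exact Filter.Eventually.of_forall fun x =>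
      ((continuous_const.min continuous_id).mul continuous_const).continuousAt

theorem exists_crossing {a b : ℝ} {f : ℝ → ℝ}
    (h : ∀ x ∈ Ioo a b, ∀ y ∈ Ioo a b, x ≤ y → 0 < f x → 0 ≤ f y) :
    ∃ t, (∀ x ∈ Ioo a b, x < t → f x ≤ 0) ∧ ∀ x ∈ Ioo a b, t < x → 0 ≤ f x := by
  by_cases he : ∃ y ∈ Ioo a b, 0 < f y
  · refine ⟨sInf {y ∈ Ioo a b | 0 < f y}, fun x hx hlt => ?_, fun x hx hlt => ?_⟩
    · by_contra hcon
      exact hlt.not_ge (csInf_le ⟨a, fun y hy => hy.1.1.le⟩ ⟨hx, not_le.1 hcon⟩)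
    · obtain ⟨y, ⟨hy, hy'⟩, hyx⟩ := exists_lt_of_csInf_lt he hlt
      exact h y hy x hx hyx.le hy'
  · push Not at he
    exact ⟨b, fun x hx _ => he x hx, fun x hx h => absurd hx.2 h.not_gt⟩

/-- On an interval where the ratio decreases, capping the payment at a constant while keeping its
mean raises the integral against the numerator. -/
theorem exists_cap {H φ ψ : ℝ → ℝ} (hH : IsSecurity H) (hφi : IntegrableOn φ (Icc 0 1))
    (hψi : IntegrableOn ψ (Icc 0 1)) (hφ : ∀ x ∈ Icc (0 : ℝ) 1, 0 < φ x) {a b : ℝ}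
    (ha : a ∈ Icc (0 : ℝ) 1) (hb : b ∈ Icc (0 : ℝ) 1) (hab : a ≤ b)
    (hρ : AntitoneOn (fun x => ψ x / φ x) (Ioo a b)) :
    ∃ c ∈ Icc (H a) (H b), ∫ x in a..b, min x c * φ x = ∫ x in a..b, H x * φ x ∧
      ∫ x in a..b, H x * ψ x ≤ ∫ x in a..b, min x c * ψ x := by
  have hsub : Ioo a b ⊆ Icc 0 1 := Ioo_subset_Icc_self.trans (Icc_subset_Icc ha.1 hb.2)
  have hφ' : ∀ x ∈ Ioo a b, 0 < φ x := fun x hx => hφ x (hsub hx)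
  have iH : ∀ {w : ℝ → ℝ}, IntegrableOn w (Icc 0 1) →
      IntervalIntegrable (fun x => H x * w x) volume a b := fun hw =>
    intervalIntegrable_sub (hH.integrableOn_mul hw) ha hb
  have iM : ∀ {w : ℝ → ℝ}, IntegrableOn w (Icc 0 1) → ∀ c,
      IntervalIntegrable (fun x => min x c * w x) volume a b := fun hw c =>
    intervalIntegrable_sub (integrableOn_min_mul hw c) ha hb
  have hlo : ∫ x in a..b, min x (H a) * φ x ≤ ∫ x in a..b, H x * φ x :=
    integral_le_integral_of_le_Ioo hab (fun x hx => (hφ' x hx).le)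
      (fun x hx => (min_le_right _ _).trans (hH.mono ha (hsub hx) hx.1.le)) (iM hφi _) (iH hφi)
  have hhi : ∫ x in a..b, H x * φ x ≤ ∫ x in a..b, min x (H b) * φ x :=
    integral_le_integral_of_le_Ioo hab (fun x hx => (hφ' x hx).le)
      (fun x hx => le_min (hH.le_self x (hsub hx)) (hH.mono (hsub hx) hb hx.2.le))
      (iH hφi) (iM hφi _)
  -- The cap `H a` pays too little and the cap `H b` too much. Keeping `c` between them is what
  -- orders the caps of successive intervals.
  obtain ⟨c, hc, hceq⟩ := intermediate_value_Icc (hH.mono ha hb hab)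
    (continuous_integral_min_mul hφi ha hb hab).continuousOn ⟨hlo, hhi⟩
  beta_reduce at hceq
  refine ⟨c, hc, hceq, ?_⟩
  have hD : ∀ w : ℝ → ℝ, (fun x => (H x - min x c) * w x)
      = fun x => H x * w x - min x c * w x := fun w => by ext x; ring
  have iD : ∀ {w : ℝ → ℝ}, IntegrableOn w (Icc 0 1) →
      IntervalIntegrable (fun x => H x * w x - min x c * w x) volume a b := fun hw =>
    (iH hw).sub (iM hw c)
  have hψn : IntegrableOn (fun x => -ψ x) (Icc 0 1) := hψi.neg
  have cr : ∃ t, (∀ x ∈ Ioo a b, x < t → H x - min x c ≤ 0) ∧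
      ∀ x ∈ Ioo a b, t < x → 0 ≤ H x - min x c := by
    refine exists_crossing fun x hx y hy hxy h => ?_
    -- Since `H x ≤ x`, the payment can exceed `min x c` only by exceeding `c`, and monotonicity
    -- preserves this to the right.
    have hcx : c < H x := by
      by_contra hcon
      rcases min_choice x c with h' | h'
      · rw [h'] at h; linarith [hH.le_self x (hsub hx)]
      · rw [h'] at h; linarith
    linarith [hH.mono (hsub hx) (hsub hy) hxy, min_le_right y c]
  obtain ⟨t, ht1, ht2⟩ := cr
  have key := integral_mul_nonneg_of_crossing (t := t) hab (D := fun x => H x - min x c)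
    (φ := φ) (ψ := fun x => -ψ x) hφ'
    (fun x hx y hy hxy => by
      have := hρ hx hy hxy
      simp only [neg_div] at this ⊢
      linarith) ht1 ht2
    (by rw [hD]; exact iD hφi) (by rw [hD]; exact iD hψn)
    (by rw [hD, intervalIntegral.integral_sub (iH hφi) (iM hφi c), hceq, sub_self])
  rw [hD (fun x => -ψ x), intervalIntegral.integral_sub (iH hψn) (iM hψn c)] at key
  simp only [mul_neg, intervalIntegral.integral_neg] at key
  linarith

/-- On an interval where the ratio increases, jumping from a low to a high cap while keeping the
mean raises the integral against the numerator. -/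
theorem exists_jump {H φ ψ : ℝ → ℝ} (hH : IsSecurity H) (hφi : IntegrableOn φ (Icc 0 1))
    (hψi : IntegrableOn ψ (Icc 0 1)) (hφ : ∀ x ∈ Icc (0 : ℝ) 1, 0 < φ x) {a b c d : ℝ}
    (ha : a ∈ Icc (0 : ℝ) 1) (hb : b ∈ Icc (0 : ℝ) 1) (hab : a ≤ b)
    (hρ : MonotoneOn (fun x => ψ x / φ x) (Ioo a b)) (hc : ∀ x ∈ Ioo a b, c ≤ H x)
    (hd : ∀ x ∈ Ioo a b, H x ≤ d) :
    ∃ t ∈ Icc a b,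
      (∫ x in a..t, min x c * φ x) + (∫ x in t..b, min x d * φ x) = ∫ x in a..b, H x * φ x ∧
      ∫ x in a..b, H x * ψ x ≤
        (∫ x in a..t, min x c * ψ x) + ∫ x in t..b, min x d * ψ x := by
  have hsub : Ioo a b ⊆ Icc 0 1 := Ioo_subset_Icc_self.trans (Icc_subset_Icc ha.1 hb.2)
  have hφ' : ∀ x ∈ Ioo a b, 0 < φ x := fun x hx => hφ x (hsub hx)
  have hIcc : Icc a b ⊆ Icc 0 1 := Icc_subset_Icc ha.1 hb.2
  have hdH : ∀ x ∈ Ioo a b, H x ≤ min x d := fun x hx => le_min (hH.le_self x (hsub hx)) (hd x hx)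
  have hcH : ∀ x ∈ Ioo a b, min x c ≤ H x := fun x hx => (min_le_right _ _).trans (hc x hx)
  have iH : ∀ {w : ℝ → ℝ}, IntegrableOn w (Icc 0 1) → ∀ {p q : ℝ}, p ∈ Icc a b → q ∈ Icc a b →
      IntervalIntegrable (fun x => H x * w x) volume p q := fun hw _ _ hp hq =>
    intervalIntegrable_sub (hH.integrableOn_mul hw) (hIcc hp) (hIcc hq)
  have iM : ∀ {w : ℝ → ℝ}, IntegrableOn w (Icc 0 1) → ∀ c {p q : ℝ}, p ∈ Icc a b → q ∈ Icc a b →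
      IntervalIntegrable (fun x => min x c * w x) volume p q := fun hw c _ _ hp hq =>
    intervalIntegrable_sub (integrableOn_min_mul hw c) (hIcc hp) (hIcc hq)
  have hla : a ∈ Icc a b := left_mem_Icc.2 hab
  have hrb : b ∈ Icc a b := right_mem_Icc.2 hab
  have hcont : ContinuousOn
      (fun t => (∫ x in a..t, min x c * φ x) + ∫ x in t..b, min x d * φ x) (Icc a b) := by
    have e : ∀ t ∈ Icc a b, (∫ x in a..t, min x c * φ x) + ∫ x in t..b, min x d * φ x
        = (∫ x in a..t, min x c * φ x) +
          ((∫ x in a..b, min x d * φ x) - ∫ x in a..t, min x d * φ x) := fun t ht => by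
      rw [intervalIntegral.integral_interval_sub_left (iM hφi d hla hrb) (iM hφi d hla ht)]
    refine ContinuousOn.congr ?_ e
    have hp : ∀ e, ContinuousOn (fun t => ∫ x in a..t, min x e * φ x) (Icc a b) := fun e => by
      have := intervalIntegral.continuousOn_primitive_interval (μ := volume) (a := a) (b := b)
        (f := fun x => min x e * φ x)
        ((integrableOn_min_mul hφi e).mono_set (by rw [uIcc_of_le hab]; exact hIcc))
      rwa [uIcc_of_le hab] at this
    exact (hp c).add (continuousOn_const.sub (hp d))
  have hlo : (∫ x in a..b, min x c * φ x) + (∫ x in b..b, min x d * φ x)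
      ≤ ∫ x in a..b, H x * φ x := by
    rw [intervalIntegral.integral_same, add_zero]
    exact integral_le_integral_of_le_Ioo hab (fun x hx => (hφ' x hx).le) hcH (iM hφi _ hla hrb)
      (iH hφi hla hrb)
  have hhi : ∫ x in a..b, H x * φ x
      ≤ (∫ x in a..a, min x c * φ x) + (∫ x in a..b, min x d * φ x) := by
    rw [intervalIntegral.integral_same, zero_add]
    exact integral_le_integral_of_le_Ioo hab (fun x hx => (hφ' x hx).le) hdH
      (iH hφi hla hrb) (iM hφi _ hla hrb)
  -- Jumping at `b` uses only the low cap and pays too little; jumping at `a` uses only the high cap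
  -- and pays too much.
  obtain ⟨t, ht, hteq⟩ := intermediate_value_Icc' hab hcont ⟨hlo, hhi⟩
  beta_reduce at hteq
  refine ⟨t, ht, hteq, ?_⟩
  set D : ℝ → ℝ := fun x => (if x < t then min x c else min x d) - H x with hDdef
  have e1 : ∀ w : ℝ → ℝ, ∀ x ∈ Ioo a t, D x * w x = min x c * w x - H x * w x :=
    fun w x hx => by simp only [hDdef, if_pos hx.2]; ring
  have e2 : ∀ w : ℝ → ℝ, ∀ x ∈ Ioo t b, D x * w x = min x d * w x - H x * w x :=
    fun w x hx => by simp only [hDdef, if_neg hx.1.not_gt]; ring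
  have iD1 : ∀ {w : ℝ → ℝ}, IntegrableOn w (Icc 0 1) →
      IntervalIntegrable (fun x => D x * w x) volume a t := fun {w} hw =>
    ((iM hw c hla ht).sub (iH hw hla ht)).congr_uIoo (g := fun x => D x * w x)
      (by rw [uIoo_of_le ht.1]; exact fun x hx => (e1 w x hx).symm)
  have iD2 : ∀ {w : ℝ → ℝ}, IntegrableOn w (Icc 0 1) →
      IntervalIntegrable (fun x => D x * w x) volume t b := fun {w} hw =>
    ((iM hw d ht hrb).sub (iH hw ht hrb)).congr_uIoo (g := fun x => D x * w x)
      (by rw [uIoo_of_le ht.2]; exact fun x hx => (e2 w x hx).symm)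
  have hint : ∀ {w : ℝ → ℝ}, IntegrableOn w (Icc 0 1) → ∫ x in a..b, D x * w x
      = (∫ x in a..t, min x c * w x) + (∫ x in t..b, min x d * w x) - ∫ x in a..b, H x * w x := by
    intro w hw
    rw [← intervalIntegral.integral_add_adjacent_intervals (iD1 hw) (iD2 hw),
      ← intervalIntegral.integral_add_adjacent_intervals (iH hw hla ht) (iH hw ht hrb),
      integral_eq_of_eqOn_Ioo ht.1 (e1 w), integral_eq_of_eqOn_Ioo ht.2 (e2 w),
      intervalIntegral.integral_sub (iM hw c hla ht) (iH hw hla ht),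
      intervalIntegral.integral_sub (iM hw d ht hrb) (iH hw ht hrb)]
    ring
  have key := integral_mul_nonneg_of_crossing (t := t) hab (D := D) (φ := φ) (ψ := ψ) hφ' hρ
    (fun x hx h => by simp only [hDdef, if_pos h]; linarith [hcH x hx])
    (fun x hx h => by simp only [hDdef, if_neg h.not_gt]; linarith [hdH x hx])
    ((iD1 hφi).trans (iD2 hφi)) ((iD1 hψi).trans (iD2 hψi))
    (by rw [hint hφi, hteq, sub_self])
  rw [hint hψi] at key
  linarith

/-! ### Gluing the replacements over all break points -/

/-- Break points `r 0 ≤ u 0 ≤ r 1 ≤ u 1 ≤ ⋯` of `[0,1]` such that `ρ` decreases on each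
`(r i, u i)` and increases on each `(u i, r (i + 1))`. -/
structure Breaks (n : ℕ) (ρ : ℝ → ℝ) (r u : ℕ → ℝ) : Prop where
  zero : r 0 = 0
  last : ∀ i, n < i → r i = 1
  le_left : ∀ i, r i ≤ u i
  le_right : ∀ i, u i ≤ r (i + 1)
  anti : ∀ i, AntitoneOn ρ (Ioo (r i) (u i))
  mono : ∀ i, MonotoneOn ρ (Ioo (u i) (r (i + 1)))

/-- Every security is matched by a stair with the same mean and a larger integral against the
numerator of the ratio. -/
theorem exists_stair_ge {H φ ψ : ℝ → ℝ} (hH : IsSecurity H) (hφi : IntegrableOn φ (Icc 0 1))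
    (hψi : IntegrableOn ψ (Icc 0 1)) (hφ : ∀ x ∈ Icc (0 : ℝ) 1, 0 < φ x) {n : ℕ} {r u : ℕ → ℝ}
    (hB : Breaks n (fun x => ψ x / φ x) r u) :
    ∃ s m, Steps n s m ∧
      ∫ x in (0 : ℝ)..1, stair n s m x * φ x = ∫ x in (0 : ℝ)..1, H x * φ x ∧
      ∫ x in (0 : ℝ)..1, H x * ψ x ≤ ∫ x in (0 : ℝ)..1, stair n s m x * ψ x := by
  have hrmono : Monotone r := monotone_nat_of_le_succ fun i => (hB.le_left i).trans (hB.le_right i)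
  have hr : ∀ i, r i ∈ Icc (0 : ℝ) 1 := fun i =>
    ⟨hB.zero ▸ hrmono (Nat.zero_le i),
      (hrmono (by omega : i ≤ n + 1 + i)).trans (hB.last _ (by omega)).le⟩
  have hu : ∀ i, u i ∈ Icc (0 : ℝ) 1 := fun i =>
    ⟨(hr i).1.trans (hB.le_left i), (hB.le_right i).trans (hr _).2⟩
  have hu1 : ∀ i, n < i → u i = 1 := fun i hi =>
    le_antisymm (hu i).2 ((hB.last i hi).symm.le.trans (hB.le_left i))
  -- Beyond `n` the intervals collapse to the point 1, so the integrals vanish and the cap can be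
  -- the non-binding value 1 that `Steps` asks for.
  have capEx : ∀ i, ∃ c, (i ≤ n → c ∈ Icc (H (r i)) (H (u i))) ∧ (n < i → c = 1) ∧
      ∫ x in (r i)..(u i), min x c * φ x = ∫ x in (r i)..(u i), H x * φ x ∧
      ∫ x in (r i)..(u i), H x * ψ x ≤ ∫ x in (r i)..(u i), min x c * ψ x := by
    intro i
    by_cases hi : i ≤ n
    · obtain ⟨c, h1, h2, h3⟩ :=
        exists_cap hH hφi hψi hφ (hr i) (hu i) (hB.le_left i) (hB.anti i)
      exact ⟨c, fun _ => h1, fun h => absurd hi (by omega), h2, h3⟩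
    · refine ⟨1, fun h => absurd h hi, fun _ => rfl, ?_⟩
      simp [hu1 i (by omega), hB.last i (by omega)]
  choose m hm1 hm2 hm3 hm4 using capEx
  have jumpEx : ∀ i, ∃ t ∈ Icc (u i) (r (i + 1)),
      (∫ x in (u i)..t, min x (m i) * φ x) + (∫ x in t..(r (i + 1)), min x (m (i + 1)) * φ x)
        = ∫ x in (u i)..(r (i + 1)), H x * φ x ∧
      ∫ x in (u i)..(r (i + 1)), H x * ψ x ≤
        (∫ x in (u i)..t, min x (m i) * ψ x) +
          ∫ x in t..(r (i + 1)), min x (m (i + 1)) * ψ x := by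
    intro i
    by_cases hi : i ≤ n
    -- The caps from the two neighboring decreasing pieces bracket `H` here: `m i ≤ H (u i)` and,
    -- for `i < n`, `H (r (i + 1)) ≤ m (i + 1)`; the last cap is 1.
    · refine exists_jump hH hφi hψi hφ (hu i) (hr _) (hB.le_right i) (hB.mono i) ?_ ?_
      · intro x hx
        have hx' : x ∈ Icc (0 : ℝ) 1 := ⟨(hu i).1.trans hx.1.le, hx.2.le.trans (hr _).2⟩
        exact (hm1 i hi).2.trans (hH.mono (hu i) hx' hx.1.le)
      · intro x hx
        have hx' : x ∈ Icc (0 : ℝ) 1 := ⟨(hu i).1.trans hx.1.le, hx.2.le.trans (hr _).2⟩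
        by_cases hi' : i + 1 ≤ n
        · exact (hH.mono hx' (hr _) hx.2.le).trans (hm1 _ hi').1
        · rw [hm2 (i + 1) (by omega)]
          exact (hH.le_self x hx').trans hx'.2
    · refine ⟨1, ?_, ?_⟩
      · simp [hu1 i (by omega), hB.last (i + 1) (by omega)]
      · simp [hu1 i (by omega), hB.last (i + 1) (by omega)]
  choose t ht1 ht2 ht3 using jumpEx
  -- Regime `i + 1` starts at the jump `t i`, inside the increasing piece before `r (i + 1)`; thus
  -- each decreasing piece lies in a single regime.
  set s : ℕ → ℝ := fun i => Nat.casesOn i 0 t with hs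
  have hs0 : s 0 = 0 := rfl
  have hss : ∀ i, s (i + 1) = t i := fun i => rfl
  have hsr : ∀ i, s i ≤ r i := by
    intro i
    cases i with
    | zero => exact hB.zero.symm.le
    | succ i => exact (ht1 i).2
  have hm01 : ∀ i, 0 ≤ m i ∧ m i ≤ 1 := by
    intro i
    by_cases hi : i ≤ n
    · exact ⟨(hH.nonneg _ (hr i)).trans (hm1 i hi).1,
        (hm1 i hi).2.trans ((hH.le_self _ (hu i)).trans (hu i).2)⟩
    · rw [hm2 i (by omega)]; exact ⟨zero_le_one, le_rfl⟩
  have hS : Steps n s m := by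
    refine ⟨monotone_nat_of_le_succ fun i => ?_, hs0, monotone_nat_of_le_succ fun i => ?_,
      (hm01 0).1, hm2⟩
    · exact (hsr i).trans ((hB.le_left i).trans (ht1 i).1)
    · by_cases hi : i + 1 ≤ n
      · exact ((hm1 i (by omega)).2.trans (hH.mono (hu i) (hr _) (hB.le_right i))).trans
          (hm1 _ hi).1
      · rw [hm2 (i + 1) (by omega)]; exact (hm01 i).2
  have pA : ∀ i ≤ n, ∀ x ∈ Ioo (r i) (u i), stair n s m x = min x (m i) := fun i hi x hx =>
    hS.stair_eq (by omega) ((hsr i).trans hx.1.le) (Or.inr (hx.2.trans_le (ht1 i).1))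
  have pB : ∀ i ≤ n, ∀ x ∈ Ioo (u i) (t i), stair n s m x = min x (m i) := fun i hi x hx =>
    hS.stair_eq (by omega) ((hsr i).trans ((hB.le_left i).trans hx.1.le)) (Or.inr hx.2)
  have pC : ∀ i ≤ n, ∀ x ∈ Ioo (t i) (r (i + 1)), stair n s m x = min x (m (i + 1)) :=
    fun i hi x hx => hS.stair_eq (by omega) hx.1.le
      (Or.inr (hx.2.trans_le ((hB.le_left _).trans (ht1 _).1)))
  have htI : ∀ i, t i ∈ Icc (0 : ℝ) 1 := fun i =>
    ⟨(hu i).1.trans (ht1 i).1, (ht1 i).2.trans (hr _).2⟩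
  have hz : (0 : ℝ) ∈ Icc (0 : ℝ) 1 := left_mem_Icc.2 zero_le_one
  have split : ∀ {f : ℝ → ℝ}, IntegrableOn f (Icc 0 1) → ∀ i,
      ∫ x in (0 : ℝ)..(r (i + 1)), f x = (∫ x in (0 : ℝ)..(r i), f x)
        + (∫ x in (r i)..(u i), f x) + ∫ x in (u i)..(r (i + 1)), f x := by
    intro f hf i
    rw [intervalIntegral.integral_add_adjacent_intervals
        (intervalIntegrable_sub hf hz (hr i)) (intervalIntegrable_sub hf (hr i) (hu i)),
      intervalIntegral.integral_add_adjacent_intervals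
        (intervalIntegrable_sub hf hz (hu i)) (intervalIntegrable_sub hf (hu i) (hr _))]
  have stairSplit : ∀ {w : ℝ → ℝ}, IntegrableOn w (Icc 0 1) → ∀ i ≤ n,
      ∫ x in (0 : ℝ)..(r (i + 1)), stair n s m x * w x
        = (∫ x in (0 : ℝ)..(r i), stair n s m x * w x)
        + (∫ x in (r i)..(u i), min x (m i) * w x)
        + ((∫ x in (u i)..(t i), min x (m i) * w x)
          + ∫ x in (t i)..(r (i + 1)), min x (m (i + 1)) * w x) := by
    intro w hw i hi
    have hK := hS.isSecurity.integrableOn_mul hw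
    rw [split hK i, ← intervalIntegral.integral_add_adjacent_intervals
      (intervalIntegrable_sub hK (hu i) (htI i)) (intervalIntegrable_sub hK (htI i) (hr _)),
      integral_eq_of_eqOn_Ioo (hB.le_left i) (fun x hx => by rw [pA i hi x hx]),
      integral_eq_of_eqOn_Ioo (ht1 i).1 (fun x hx => by rw [pB i hi x hx]),
      integral_eq_of_eqOn_Ioo (ht1 i).2 (fun x hx => by rw [pC i hi x hx])]
  have main : ∀ i ≤ n + 1,
      ∫ x in (0 : ℝ)..(r i), stair n s m x * φ x = ∫ x in (0 : ℝ)..(r i), H x * φ x ∧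
      ∫ x in (0 : ℝ)..(r i), H x * ψ x ≤ ∫ x in (0 : ℝ)..(r i), stair n s m x * ψ x := by
    intro i
    induction i with
    | zero => intro _; simp [hB.zero]
    | succ i ih =>
      intro hi
      obtain ⟨h1, h2⟩ := ih (by omega)
      rw [stairSplit hφi i (by omega), stairSplit hψi i (by omega),
        split (hH.integrableOn_mul hφi) i, split (hH.integrableOn_mul hψi) i]
      refine ⟨by rw [h1, hm3, ht2], by linarith [hm4 i, ht3 i]⟩
  have := main (n + 1) le_rfl
  rw [hB.last (n + 1) (by omega)] at this
  exact ⟨s, m, hS, this⟩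

/-! ### Intermediate values at a fixed mean -/

/-- Ordered securities with equal means under a positive density agree almost everywhere. -/
theorem integral_mul_eq_of_le {f g φ : ℝ → ℝ} (ψ : ℝ → ℝ) (hf : IsSecurity f)
    (hg : IsSecurity g) (hφi : IntegrableOn φ (Icc 0 1)) (hφ : ∀ x ∈ Icc (0 : ℝ) 1, 0 < φ x)
    (hle : ∀ x, f x ≤ g x)
    (h : ∫ x in (0 : ℝ)..1, f x * φ x = ∫ x in (0 : ℝ)..1, g x * φ x) :
    ∫ x in (0 : ℝ)..1, f x * ψ x = ∫ x in (0 : ℝ)..1, g x * ψ x := by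
  rw [intervalIntegral.integral_of_le zero_le_one, intervalIntegral.integral_of_le zero_le_one]
    at h ⊢
  have hfi := (hf.integrableOn_mul hφi).mono_set Ioc_subset_Icc_self
  have hgi := (hg.integrableOn_mul hφi).mono_set Ioc_subset_Icc_self
  have h1 := (setIntegral_eq_zero_iff_of_nonneg_ae (f := fun x => g x * φ x - f x * φ x)
    (by
      filter_upwards [ae_restrict_mem measurableSet_Ioc] with x hx
      exact sub_nonneg.2 (mul_le_mul_of_nonneg_right (hle x) (hφ x (Ioc_subset_Icc_self hx)).le))
    (hgi.sub hfi)).1 (by rw [integral_sub hgi hfi, h, sub_self])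
  refine integral_congr_ae ?_
  filter_upwards [h1, ae_restrict_mem measurableSet_Ioc] with x hx hm
  have := mul_right_cancel₀ (hφ x (Ioc_subset_Icc_self hm)).ne' (sub_eq_zero.1 hx)
  rw [this]

/-- The family of stairs attains all intermediate values of a second integral along which the mean
stays fixed. -/
theorem exists_stair_eq {n : ℕ} {s m s' m' : ℕ → ℝ} {φ ψ : ℝ → ℝ} (h : Steps n s m)
    (h' : Steps n s' m') (hφi : IntegrableOn φ (Icc 0 1)) (hψi : IntegrableOn ψ (Icc 0 1))
    (hφ : ∀ x ∈ Icc (0 : ℝ) 1, 0 < φ x) {R c : ℝ}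
    (hR : ∫ x in (0 : ℝ)..1, stair n s m x * φ x = R)
    (hR' : ∫ x in (0 : ℝ)..1, stair n s' m' x * φ x = R)
    (hc : ∫ x in (0 : ℝ)..1, stair n s m x * ψ x ≤ c)
    (hc' : c ≤ ∫ x in (0 : ℝ)..1, stair n s' m' x * ψ x) :
    ∃ s m, Steps n s m ∧ ∫ x in (0 : ℝ)..1, stair n s m x * φ x = R ∧
      ∫ x in (0 : ℝ)..1, stair n s m x * ψ x = c := by
  -- The first coordinate interpolates between the two stairs. The second moves break points left
  -- and caps up, both of which raise the payment, and serves to restore the mean. Truncation keeps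
  -- the parameters admissible.
  set S : ℝ × ℝ → ℕ → ℝ := fun p i =>
    if i = 0 then 0 else max 0 ((1 - p.1) * s i + p.1 * s' i - p.2) with hSdef
  set C : ℝ × ℝ → ℕ → ℝ := fun p i =>
    if i ≤ n then max 0 (min 1 ((1 - p.1) * m i + p.1 * m' i + p.2)) else 1 with hCdef
  have hs0 : ∀ i, 0 ≤ s i := fun i => h.zero_s ▸ h.mono_s (Nat.zero_le i)
  have hs0' : ∀ i, 0 ≤ s' i := fun i => h'.zero_s ▸ h'.mono_s (Nat.zero_le i)
  have hScont : ∀ i, Continuous fun p => S p i := fun i => by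
    by_cases hi : i = 0
    · simp only [hSdef, hi, if_true]; fun_prop
    · simp only [hSdef, hi, if_false]; fun_prop
  have hCcont : ∀ i, Continuous fun p => C p i := fun i => by
    by_cases hi : i ≤ n
    · simp only [hCdef, hi, if_true]; fun_prop
    · simp only [hCdef, hi, if_false]; fun_prop
  have hC0 : ∀ p i, 0 ≤ C p i := fun p i => by
    by_cases hi : i ≤ n <;> simp [hCdef, hi]
  have hC1 : ∀ p i, C p i ≤ 1 := fun p i => by
    by_cases hi : i ≤ n <;> simp [hCdef, hi]
  have hsteps : ∀ p : ℝ × ℝ, p.1 ∈ Icc (0 : ℝ) 1 → Steps n (S p) (C p) := by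
    intro p hp
    have hp1 : 0 ≤ 1 - p.1 := sub_nonneg.2 hp.2
    refine ⟨monotone_nat_of_le_succ fun i => ?_, by simp [hSdef],
      monotone_nat_of_le_succ fun i => ?_, hC0 p 0, fun i hi => by simp [hCdef, not_le.2 hi]⟩
    · by_cases hi : i = 0
      · simp [hSdef, hi]
      · simp only [hSdef, hi, if_false, Nat.succ_ne_zero]
        have h1 := mul_le_mul_of_nonneg_left (h.mono_s i.le_succ) hp1
        have h2 := mul_le_mul_of_nonneg_left (h'.mono_s i.le_succ) hp.1
        exact max_le_max le_rfl (by linarith)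
    · by_cases hi : i + 1 ≤ n
      · have hi' : i ≤ n := by omega
        simp only [hCdef, hi, hi', if_true]
        have h1 := mul_le_mul_of_nonneg_left (h.mono_m i.le_succ) hp1
        have h2 := mul_le_mul_of_nonneg_left (h'.mono_m i.le_succ) hp.1
        exact max_le_max le_rfl (min_le_min le_rfl (by linarith))
      · have : C p (i + 1) = 1 := by simp only [hCdef, hi, if_false]
        rw [this]; exact hC1 p i
  have hmono : ∀ τ ∈ Icc (0 : ℝ) 1, ∀ σ σ' : ℝ, σ ≤ σ' → ∀ x,
      stair n (S (τ, σ)) (C (τ, σ)) x ≤ stair n (S (τ, σ')) (C (τ, σ')) x := by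
    intro τ hτ σ σ' hσ x
    refine (hsteps (τ, σ) hτ).mono (fun i => ?_) (fun i => ?_) x
    · by_cases hi : i = 0
      · simp [hSdef, hi]
      · simp only [hSdef, hi, if_false]
        exact max_le_max le_rfl (by linarith)
    · by_cases hi : i ≤ n
      · simp only [hCdef, hi, if_true]
        exact max_le_max le_rfl (min_le_min le_rfl (by linarith))
      · simp [hCdef, hi]
  set F : ℝ × ℝ → ℝ := fun p => ∫ x in (0 : ℝ)..1, stair n (S p) (C p) x * φ x with hF
  set Q : ℝ × ℝ → ℝ := fun p => ∫ x in (0 : ℝ)..1, stair n (S p) (C p) x * ψ x with hQ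
  have hFc : Continuous F := continuous_integral_stair hScont hCcont hC0 n hφi
  have hQc : Continuous Q := continuous_integral_stair hScont hCcont hC0 n hψi
  have e0 : S (0, 0) = s ∧ C (0, 0) = m := by
    constructor
    · ext i
      by_cases hi : i = 0
      · simp [hSdef, hi, h.zero_s]
      · simp [hSdef, hi, hs0 i]
    · ext i
      by_cases hi : i ≤ n
      · simp [hCdef, hi, h.m_nonneg i, h.m_le_one i]
      · simp [hCdef, hi, h.last i (not_le.1 hi)]
  have e1 : S (1, 0) = s' ∧ C (1, 0) = m' := by
    constructor
    · ext i
      by_cases hi : i = 0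
      · simp [hSdef, hi, h'.zero_s]
      · simp [hSdef, hi, hs0' i]
    · ext i
      by_cases hi : i ≤ n
      · simp [hCdef, hi, h'.m_nonneg i, h'.m_le_one i]
      · simp [hCdef, hi, h'.last i (not_le.1 hi)]
  -- A shift of `-1` gives a security that pays nothing inside the unit interval; a shift of `B`
  -- starts the last regime at 0, so the whole profit is paid. Some shift in between has mean `R`.
  set B : ℝ := max (s (n + 1)) (s' (n + 1)) with hB
  have hB0 : 0 ≤ B := (hs0 _).trans (le_max_left _ _)
  have hφ0 : ∀ x ∈ Ioo (0 : ℝ) 1, 0 ≤ φ x := fun x hx => (hφ x (Ioo_subset_Icc_self hx)).le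
  have hz : (0 : ℝ) ∈ Icc (0 : ℝ) 1 := left_mem_Icc.2 zero_le_one
  have ho : (1 : ℝ) ∈ Icc (0 : ℝ) 1 := right_mem_Icc.2 zero_le_one
  have hKi := intervalIntegrable_sub (h.isSecurity.integrableOn_mul hφi) hz ho
  have hbot : ∀ τ ∈ Icc (0 : ℝ) 1, F (τ, -1) ≤ R := by
    intro τ hτ
    rw [← hR]
    have hst := hsteps (τ, -1) hτ
    refine integral_le_integral_of_le_Ioo zero_le_one hφ0 (fun x hx => ?_)
      (intervalIntegrable_sub (hst.isSecurity.integrableOn_mul hφi) hz ho) hKi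
    have hS1 : (1 : ℝ) ≤ S (τ, -1) 1 := by
      simp only [hSdef, one_ne_zero, if_false]
      have h1 := mul_nonneg (sub_nonneg.2 hτ.2) (hs0 1)
      have h2 := mul_nonneg hτ.1 (hs0' 1)
      exact le_max_of_le_right (by linarith)
    rw [hst.stair_eq (i := 0) (Nat.zero_le _) (by rw [hst.zero_s]; exact hx.1.le)
      (Or.inr (hx.2.trans_le hS1))]
    have hC : C (τ, -1) 0 = 0 := by
      simp only [hCdef, Nat.zero_le, if_true]
      have h1 := mul_le_mul_of_nonneg_left (h.m_le_one 0) (sub_nonneg.2 hτ.2)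
      have h2 := mul_le_mul_of_nonneg_left (h'.m_le_one 0) hτ.1
      exact max_eq_left ((min_le_right _ _).trans (by linarith))
    rw [hC]
    exact (min_le_right _ _).trans (h.isSecurity.nonneg x (Ioo_subset_Icc_self hx))
  have htop : ∀ τ ∈ Icc (0 : ℝ) 1, R ≤ F (τ, B) := by
    intro τ hτ
    rw [← hR]
    have hst := hsteps (τ, B) hτ
    refine integral_le_integral_of_le_Ioo zero_le_one hφ0 (fun x hx => ?_)
      hKi (intervalIntegrable_sub (hst.isSecurity.integrableOn_mul hφi) hz ho)
    have hS0 : S (τ, B) (n + 1) = 0 := by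
      simp only [hSdef, Nat.add_eq_zero_iff, one_ne_zero, and_false, if_false]
      have h1 := mul_le_mul_of_nonneg_left (le_max_left (s (n + 1)) (s' (n + 1)))
        (sub_nonneg.2 hτ.2)
      have h2 := mul_le_mul_of_nonneg_left (le_max_right (s (n + 1)) (s' (n + 1))) hτ.1
      exact max_eq_left (by rw [hB]; linarith)
    rw [hst.stair_eq (i := n + 1) le_rfl (by rw [hS0]; exact hx.1.le) (Or.inl rfl),
      hst.last _ n.lt_succ_self, min_eq_left hx.2.le]
    exact h.isSecurity.le_self x (Ioo_subset_Icc_self hx)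
  have hex : ∀ τ ∈ Icc (0 : ℝ) 1, ∃ σ ∈ Icc (-1) B, F (τ, σ) = R := fun τ hτ => by
    have hcont : ContinuousOn (fun σ => F (τ, σ)) (Icc (-1) B) :=
      (hFc.comp (by fun_prop : Continuous fun σ : ℝ => (τ, σ))).continuousOn
    obtain ⟨σ, h1, h2⟩ := intermediate_value_Icc (by linarith) hcont ⟨hbot τ hτ, htop τ hτ⟩
    exact ⟨σ, h1, h2⟩
  have hclosed : ∀ P : Set (ℝ × ℝ), IsClosed P →
      IsClosed (Prod.fst '' ((Icc (0 : ℝ) 1 ×ˢ Icc (-1) B) ∩ P)) := fun P hP =>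
    (((isCompact_Icc.prod isCompact_Icc).inter_right hP).image continuous_fst).isClosed
  have hPA : IsClosed {p : ℝ × ℝ | F p = R ∧ Q p ≤ c} :=
    (isClosed_eq hFc continuous_const).inter (isClosed_le hQc continuous_const)
  have hPB : IsClosed {p : ℝ × ℝ | F p = R ∧ c ≤ Q p} :=
    (isClosed_eq hFc continuous_const).inter (isClosed_le continuous_const hQc)
  have h0B : (0 : ℝ) ∈ Icc (-1) B := ⟨by norm_num, hB0⟩
  -- The shift restoring the mean need not be unique or chosen continuously. Instead, the parameters
  -- admitting a shift with `Q ≤ c` and those admitting one with `c ≤ Q` form two closed sets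
  -- covering `[0,1]`, which therefore meet.
  obtain ⟨τ, hτ, ⟨⟨τ1, σ1⟩, ⟨⟨-, -⟩, hF1, hQ1⟩, rfl⟩, ⟨⟨τ2, σ2⟩, ⟨⟨-, -⟩, hF2, hQ2⟩, h12⟩⟩ :=
    isPreconnected_closed_iff.1 (isPreconnected_Icc (a := (0 : ℝ)) (b := 1)) _ _
      (hclosed _ hPA) (hclosed _ hPB)
      (fun τ hτ => by
        obtain ⟨σ, h1, h2⟩ := hex τ hτ
        rcases le_total (Q (τ, σ)) c with h3 | h3
        · exact Or.inl ⟨(τ, σ), ⟨⟨hτ, h1⟩, h2, h3⟩, rfl⟩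
        · exact Or.inr ⟨(τ, σ), ⟨⟨hτ, h1⟩, h2, h3⟩, rfl⟩)
      ⟨0, hz, (0, 0), ⟨⟨hz, h0B⟩, by simp only [hF, e0.1, e0.2, hR],
        by simp only [hQ, e0.1, e0.2, hc]⟩, rfl⟩
      ⟨1, ho, (1, 0), ⟨⟨ho, h0B⟩, by simp only [hF, e1.1, e1.2, hR'],
        by simp only [hQ, e1.1, e1.2, hc']⟩, rfl⟩
  obtain rfl : τ2 = τ1 := h12
  have hst1 := hsteps (τ2, σ1) hτ
  have hst2 := hsteps (τ2, σ2) hτ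
  refine ⟨S (τ2, σ1), C (τ2, σ1), hst1, hF1, le_antisymm hQ1 ?_⟩
  have hFF : F (τ2, σ1) = F (τ2, σ2) := hF1.trans hF2.symm
  -- At the common parameter the two stairs are ordered by their shifts and have equal means, so
  -- they agree almost everywhere.
  have : Q (τ2, σ1) = Q (τ2, σ2) := by
    rcases le_total σ1 σ2 with hσ | hσ
    · exact integral_mul_eq_of_le ψ hst1.isSecurity hst2.isSecurity hφi hφ
        (hmono _ hτ _ _ hσ) hFF
    · exact (integral_mul_eq_of_le ψ hst2.isSecurity hst1.isSecurity hφi hφ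
        (hmono _ hτ _ _ hσ) hFF.symm).symm
  exact hQ2.trans this.symm.le

/-! ### Leaving at most two loose face values -/

/-- More than two vectors `(A d, B d)` in the plane are linearly dependent. Extending the
coefficients by zero lets them be evaluated at any cap. -/
theorem exists_relation (T : Finset ℝ) (hT : 2 < T.card) (A B : ℝ → ℝ) :
    ∃ β : ℝ → ℝ, (∀ x ∉ T, β x = 0) ∧ (∃ x ∈ T, β x ≠ 0) ∧
      ∑ d ∈ T, β d * A d = 0 ∧ ∑ d ∈ T, β d * B d = 0 := by
  have hker := LinearMap.ker_ne_bot_of_finrank_lt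
    (f := Fintype.linearCombination ℝ (fun d : T => (A d, B d)))
    (by simpa using hT)
  obtain ⟨α, hα, hα0⟩ := (Submodule.ne_bot_iff _).1 hker
  obtain ⟨d, hd⟩ := Function.ne_iff.1 hα0
  set β : ℝ → ℝ := fun x => if h : x ∈ T then α ⟨x, h⟩ else 0 with hβ
  have hβα : ∀ d : T, β d = α d := fun d => by simp [hβ]
  rw [LinearMap.mem_ker, Fintype.linearCombination_apply] at hα
  have hsum : ∀ E : ℝ → ℝ, ∑ d ∈ T, β d * E d = ∑ d : T, α d * E d := fun E => by
    rw [← Finset.sum_coe_sort T (fun d => β d * E d)]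
    exact Finset.sum_congr rfl fun d _ => by rw [hβα]
  refine ⟨β, fun x hx => by simp [hβ, hx], ⟨d, d.2, by rw [hβα]; exact hd⟩, ?_, ?_⟩
  · rw [hsum]
    simpa [Prod.fst_sum] using congrArg Prod.fst hα
  · rw [hsum]
    simpa [Prod.snd_sum] using congrArg Prod.snd hα

/-- The values below the profit at which they are paid. -/
def faces (H : ℝ → ℝ) : Set ℝ := {d | ∃ x ∈ Icc (0 : ℝ) 1, H x = d ∧ d < x}

/-- The face values that are not paid by the profit equal to them. -/
def looseFaces (H : ℝ → ℝ) : Set ℝ := {d ∈ faces H | H d ≠ d}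

theorem Steps.exists_eq_of_mem_faces {n : ℕ} {s m : ℕ → ℝ} (h : Steps n s m) {d : ℝ}
    (hd : d ∈ faces (stair n s m)) : ∃ i ≤ n, m i = d := by
  obtain ⟨x, hx, rfl, hlt⟩ := hd
  obtain ⟨i, hi, -, -, hi3⟩ := exists_level_eq (m := m) h.zero_s (n + 1) hx.1
  have hlev : stair n s m x = m i := by
    rw [stair, hi3] at hlt ⊢
    exact (min_choice x (m i)).resolve_left hlt.ne
  refine ⟨i, ?_, hlev.symm⟩
  by_contra hcon
  rw [hlev, h.last i (not_le.1 hcon)] at hlt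
  exact hlt.not_ge hx.2

/-- If `s i ≤ m i`, then at profit `m i` the regime is `i` or later, its cap is at least `m i`, and
the payment is the profit itself. Strictness leaves room to move a loose cap up. -/
theorem Steps.lt_of_mem_looseFaces {n : ℕ} {s m : ℕ → ℝ} (h : Steps n s m) {i : ℕ}
    (hd : m i ∈ looseFaces (stair n s m)) : m i < s i := by
  by_contra hcon
  rw [not_lt] at hcon
  have hi : i ≤ n := by
    by_contra hi
    obtain ⟨x, hx, -, hlt⟩ := hd.1
    rw [h.last i (not_le.1 hi)] at hlt
    exact hlt.not_ge hx.2
  obtain ⟨j, hj, h1, h2, h3⟩ := exists_level_eq (m := m) h.zero_s (n + 1) (h.m_nonneg i)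
  have hij : i ≤ j := by
    by_contra hij
    rcases h2 with rfl | h2
    · omega
    · exact (h2.trans_le (h.mono_s (by omega : j + 1 ≤ i))).not_ge hcon
  refine hd.2 ?_
  rw [stair, h3]
  exact min_eq_left (h.mono_m hij)

/-- Changing the caps of a stair, its means under two weights can be kept while all but two of its
face values get tied to the profit. -/
theorem exists_stair_ncard_looseFaces_le {n : ℕ} {s m : ℕ → ℝ} {φ ψ : ℝ → ℝ} (h : Steps n s m)
    (hφi : IntegrableOn φ (Icc 0 1)) (hψi : IntegrableOn ψ (Icc 0 1)) :
    ∃ q, Steps n s q ∧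
      ∫ x in (0 : ℝ)..1, stair n s q x * φ x = ∫ x in (0 : ℝ)..1, stair n s m x * φ x ∧
      ∫ x in (0 : ℝ)..1, stair n s q x * ψ x = ∫ x in (0 : ℝ)..1, stair n s m x * ψ x ∧
      (looseFaces (stair n s q)).ncard ≤ 2 := by
  -- The truncation at 0 makes this continuous on all sequences, and it changes nothing for
  -- admissible caps.
  set F : (ℝ → ℝ) → (ℕ → ℝ) → ℝ := fun w q =>
    ∫ x in (0 : ℝ)..1, stair n s (fun i => max 0 (q i)) x * w x with hF
  have hFc : ∀ {w : ℝ → ℝ}, IntegrableOn w (Icc 0 1) → Continuous (F w) := fun hw =>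
    continuous_integral_stair (s := fun _ => s) (fun _ => continuous_const)
      (fun i => continuous_const.max (continuous_apply i)) (fun _ _ => le_max_left _ _) n hw
  have hFeq : ∀ {q}, Steps n s q → ∀ w, F w q = ∫ x in (0 : ℝ)..1, stair n s q x * w x := by
    intro q hq w
    simp only [hF, max_eq_right (hq.m_nonneg _)]
  -- Caps tied to the profit are frozen. The others stay at or below the start of their regime,
  -- where they are paid in full, so the payment is affine in them.
  set Z : Set (ℕ → ℝ) := {q | ((∀ i, q i ≤ q (i + 1)) ∧ 0 ≤ q 0 ∧ (∀ i, n < i → q i = 1)) ∧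
    (∀ i, s i ≤ m i → q i = m i) ∧ (∀ i, m i < s i → q i ≤ s i) ∧ F φ q = F φ m ∧
    F ψ q = F ψ m} with hZ
  have hsteps : ∀ {q}, q ∈ Z → Steps n s q := fun hq =>
    ⟨h.mono_s, h.zero_s, monotone_nat_of_le_succ hq.1.1, hq.1.2.1, hq.1.2.2⟩
  have hZclosed : IsClosed Z := by
    simp only [hZ, ofPred_and, ofPred_forall]
    have ci : ∀ i, Continuous fun q : ℕ → ℝ => q i := fun i => continuous_apply i
    have c0 : ∀ c : ℝ, Continuous fun _ : ℕ → ℝ => c := fun c => continuous_const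
    refine ((isClosed_iInter fun i => isClosed_le (ci i) (ci (i + 1))).inter
      ((isClosed_le (c0 0) (ci 0)).inter (isClosed_iInter fun i =>
        isClosed_iInter fun _ => isClosed_eq (ci i) (c0 1)))).inter
      ((isClosed_iInter fun i => isClosed_iInter fun _ => isClosed_eq (ci i) (c0 (m i))).inter
      ((isClosed_iInter fun i => isClosed_iInter fun _ => isClosed_le (ci i) (c0 (s i))).inter
      ((isClosed_eq (hFc hφi) (c0 (F φ m))).inter (isClosed_eq (hFc hψi) (c0 (F ψ m))))))
  have hZc : IsCompact Z := (isCompact_univ_pi fun _ => isCompact_Icc).of_isClosed_subset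
    hZclosed fun q hq i _ => ⟨(hsteps hq).m_nonneg i, (hsteps hq).m_le_one i⟩
  have hmZ : m ∈ Z := ⟨⟨fun i => h.mono_m i.le_succ, h.nonneg, h.last⟩, fun _ _ => rfl,
    fun _ hi => hi.le, rfl, rfl⟩
  -- A maximizer of a strictly convex function of the first `n + 1` caps cannot be the midpoint of
  -- two points of `Z` that differ in those caps.
  obtain ⟨q, hqZ, hqmax⟩ := hZc.exists_isMaxOn ⟨m, hmZ⟩
    (f := fun q : ℕ → ℝ => ∑ i ∈ Finset.range (n + 1), q i ^ 2)
    (by fun_prop)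
  have hq := hsteps hqZ
  refine ⟨q, hq, by rw [← hFeq hq, ← hFeq h]; exact hqZ.2.2.2.1,
    by rw [← hFeq hq, ← hFeq h]; exact hqZ.2.2.2.2, ?_⟩
  by_contra hcard
  obtain ⟨T, hTs, hTc⟩ := Set.exists_subset_card_eq (not_le.1 hcard : 3 ≤ _)
  have hTf : T.Finite := Set.finite_of_ncard_ne_zero (by omega)
  lift T to Finset ℝ using hTf
  rw [Set.ncard_coe_finset] at hTc
  have hTl : ∀ d ∈ T, d ∈ looseFaces (stair n s q) := fun d hd => hTs hd
  set L := level s q (n + 1) with hL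
  -- The perturbation depends on a cap only through its value, so equal caps move together; the
  -- vectors are the φ- and ψ-masses of the level sets.
  obtain ⟨β, hβ0, ⟨d, hdT, hd0⟩, hβφ, hβψ⟩ := exists_relation T (by omega)
    (fun d => ∫ x in (0 : ℝ)..1, ({x | L x = d}.indicator (fun _ => (1 : ℝ)) x) * φ x)
    (fun d => ∫ x in (0 : ℝ)..1, ({x | L x = d}.indicator (fun _ => (1 : ℝ)) x) * ψ x)
  have hlt : ∀ i, q i ∈ T → q i < s i := fun i hi => hq.lt_of_mem_looseFaces (hTl _ hi)
  have hT1 : (1 : ℝ) ∉ T := fun hmem => by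
    obtain ⟨x, hx, -, hx'⟩ := (hTl 1 hmem).1
    exact hx'.not_ge hx.2
  have hle : ∀ i, q i ∈ T → i ≤ n := fun i hi => by
    by_contra hcon
    rw [hq.last i (not_le.1 hcon)] at hi
    exact hT1 hi
  have hq0 : β (q 0) = 0 := hβ0 _ fun hmem => by
    have := hlt 0 hmem
    rw [hq.zero_s] at this
    exact this.not_ge hq.nonneg
  have hβL : ∀ w : ℝ → ℝ, IntegrableOn w (Icc 0 1) →
      IntervalIntegrable (fun x => β (L x) * w x) volume 0 1 ∧
      ∫ x in (0 : ℝ)..1, β (L x) * w x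
        = ∑ d ∈ T, β d * ∫ x in (0 : ℝ)..1, ({x | L x = d}.indicator (fun _ => (1 : ℝ)) x) * w x := by
    intro w hw
    have e : (fun x => β (L x) * w x)
        = fun x => ∑ d ∈ T, β d * (({x | L x = d}.indicator (fun _ => (1 : ℝ)) x) * w x) := by
      ext x
      have : β (L x) = ∑ d ∈ T, β d * ({x | L x = d}.indicator (fun _ => (1 : ℝ)) x) := by
        simp only [indicator, mem_ofPred_eq, mul_ite, mul_one, mul_zero, Finset.sum_ite_eq]
        split_ifs with hx
        · rfl
        · exact hβ0 _ hx
      rw [this, Finset.sum_mul]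
      exact Finset.sum_congr rfl fun d _ => by ring
    have hi : ∀ d ∈ T, IntervalIntegrable
        (fun x => β d * (({x | L x = d}.indicator (fun _ => (1 : ℝ)) x) * w x)) volume 0 1 := by
      intro d _
      refine IntervalIntegrable.const_mul ?_ _
      have hms : MeasurableSet {x | L x = d} :=
        (measurable_level s q (n + 1)) (measurableSet_singleton d)
      have e : (fun x => ({x | L x = d}.indicator (fun _ => (1 : ℝ)) x) * w x)
          = {x | L x = d}.indicator w := by
        ext x
        by_cases hx : L x = d <;> simp [hx]
      rw [e]
      exact intervalIntegrable_sub (hw.indicator hms) (left_mem_Icc.2 zero_le_one)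
        (right_mem_Icc.2 zero_le_one)
    refine ⟨?_, ?_⟩
    · rw [e]
      simpa only [Finset.sum_fn] using IntervalIntegrable.sum T hi
    · rw [e, intervalIntegral.integral_finsetSum hi]
      simp only [intervalIntegral.integral_const_mul]
  -- The range `n + 2` includes the fixed cap 1 of the last regime, so that the moving caps stay
  -- below it.
  have hev : ∀ᶠ ε in nhds (0 : ℝ),
      (∀ i ∈ Finset.range (n + 2), ∀ j ∈ Finset.range (n + 2), q i < q j →
        q i + ε * β (q i) ≤ q j + ε * β (q j)) ∧
      ∀ i ∈ Finset.range (n + 2), q i ∈ T → q i + ε * β (q i) ≤ s i := by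
    refine Filter.Eventually.and ?_ ?_
    · refine (Finset.eventually_all _).2 fun i _ => (Finset.eventually_all _).2 fun j _ => ?_
      by_cases hij : q i < q j
      · have : ∀ᶠ ε in nhds (0 : ℝ), q i + ε * β (q i) < q j + ε * β (q j) :=
          ContinuousAt.eventually_lt (by fun_prop) (by fun_prop) (by simpa using hij)
        exact this.mono fun ε hε _ => hε.le
      · exact Filter.Eventually.of_forall fun ε hc => absurd hc hij
    · refine (Finset.eventually_all _).2 fun i _ => ?_
      by_cases hij : q i ∈ T
      · have : ∀ᶠ ε in nhds (0 : ℝ), q i + ε * β (q i) < s i :=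
          ContinuousAt.eventually_lt (by fun_prop) (by fun_prop) (by simpa using hlt i hij)
        exact this.mono fun ε hε _ => hε.le
      · exact Filter.Eventually.of_forall fun ε hc => absurd hc hij
  have hmem : ∀ ε : ℝ, ((∀ i ∈ Finset.range (n + 2), ∀ j ∈ Finset.range (n + 2), q i < q j →
        q i + ε * β (q i) ≤ q j + ε * β (q j)) ∧
      ∀ i ∈ Finset.range (n + 2), q i ∈ T → q i + ε * β (q i) ≤ s i) →
      (fun i => q i + ε * β (q i)) ∈ Z := by
    rintro ε ⟨h1, h2⟩
    have hst : Steps n s fun i => q i + ε * β (q i) := by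
      refine ⟨h.mono_s, h.zero_s, monotone_nat_of_le_succ fun i => ?_, ?_, fun i hi => ?_⟩
      · by_cases hi : i ≤ n
        · rcases (hq.mono_m i.le_succ).lt_or_eq with hlt | heq
          · exact h1 i (by simp; omega) (i + 1) (by simp; omega) hlt
          · rw [Nat.succ_eq_add_one] at heq
            rw [heq]
        · rw [hq.last i (by omega), hq.last (i + 1) (by omega)]
      · rw [hq0, mul_zero, add_zero]; exact hq.nonneg
      · rw [hq.last i hi, hβ0 1 hT1, mul_zero, add_zero]
    have hpt : ∀ x ∈ Ioo (0 : ℝ) 1, stair n s (fun i => q i + ε * β (q i)) x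
        = stair n s q x + ε * β (L x) := by
      intro x hx
      obtain ⟨i, hi, hi1, -, hi3⟩ := exists_level_eq (m := q) h.zero_s (n + 1) hx.1.le
      rw [stair, level_comp s q (fun y => y + ε * β y), stair, hL, hi3]
      by_cases hiT : q i ∈ T
      · rw [min_eq_right ((h2 i (by simp; omega) hiT).trans hi1),
          min_eq_right ((hlt i hiT).le.trans hi1)]
      · rw [hβ0 _ hiT, mul_zero, add_zero, add_zero]
    have hint : ∀ w : ℝ → ℝ, IntegrableOn w (Icc 0 1) →
        ∑ d ∈ T, β d * (∫ x in (0 : ℝ)..1, ({x | L x = d}.indicator (fun _ => (1 : ℝ)) x) * w x) = 0 →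
        F w (fun i => q i + ε * β (q i)) = F w q := by
      intro w hw hw0
      rw [hFeq hst, hFeq hq, integral_eq_of_eqOn_Ioo (g := fun x => stair n s q x * w x
        + ε * (β (L x) * w x)) zero_le_one (fun x hx => by rw [hpt x hx]; ring),
        intervalIntegral.integral_add
          (intervalIntegrable_sub (hq.isSecurity.integrableOn_mul hw)
            (left_mem_Icc.2 zero_le_one) (right_mem_Icc.2 zero_le_one))
          ((hβL w hw).1.const_mul _), intervalIntegral.integral_const_mul, (hβL w hw).2, hw0,
        mul_zero, add_zero]
    refine ⟨⟨fun i => hst.mono_m i.le_succ, hst.nonneg, hst.last⟩, fun i hi => ?_, fun i hi => ?_,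
      (hint φ hφi hβφ).trans hqZ.2.2.2.1, (hint ψ hψi hβψ).trans hqZ.2.2.2.2⟩
    · have hqi := hqZ.2.1 i hi
      have : q i ∉ T := fun hc => (hlt i hc).not_ge (hqi ▸ hi)
      simpa only [hβ0 _ this, mul_zero, add_zero] using hqi
    · by_cases hiT : q i ∈ T
      · exact h2 i (by simp; have := hle i hiT; omega) hiT
      · simp only [hβ0 _ hiT, mul_zero, add_zero]
        exact hqZ.2.2.1 i hi
  obtain ⟨ε, hε, hball⟩ := Metric.eventually_nhds_iff.1 hev
  have hp := hqmax (hmem (ε / 2) (hball (by simp [abs_of_pos hε]; linarith)))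
  have hm := hqmax (hmem (-(ε / 2)) (hball (by simp [abs_of_pos hε]; linarith)))
  simp only [mem_ofPred_eq] at hp hm
  obtain ⟨i, hi, rfl⟩ := hq.exists_eq_of_mem_faces (hTl d hdT).1
  -- Both opposite perturbations lie in `Z`, and by the parallelogram identity one of them has a
  -- larger sum of squares.
  have hsum : ∑ i ∈ Finset.range (n + 1), (q i + ε / 2 * β (q i)) ^ 2
      + ∑ i ∈ Finset.range (n + 1), (q i + -(ε / 2) * β (q i)) ^ 2
      = 2 * ∑ i ∈ Finset.range (n + 1), q i ^ 2
        + ε ^ 2 / 2 * ∑ i ∈ Finset.range (n + 1), β (q i) ^ 2 := by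
    rw [Finset.mul_sum, Finset.mul_sum, ← Finset.sum_add_distrib, ← Finset.sum_add_distrib]
    exact Finset.sum_congr rfl fun i _ => by ring
  have hpos : 0 < ∑ i ∈ Finset.range (n + 1), β (q i) ^ 2 :=
    Finset.sum_pos' (fun i _ => sq_nonneg _) ⟨i, by simp; omega, by positivity⟩
  have : 0 < ε ^ 2 / 2 * ∑ i ∈ Finset.range (n + 1), β (q i) ^ 2 := by positivity
  linarith

/-! ### From finitely many face values to contingent debt -/

/-- A security with finitely many face values is a contingent debt contract, whose non-defaultable
face values are loose. -/
theorem IsSecurity.exists_isContingentDebt {H : ℝ → ℝ} (hH : IsSecurity H)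
    (hfin : (faces H).Finite) :
    ∃ lo hi : Fin (faces H).ncard → ℝ, IsContingentDebt H lo hi ∧
      {n | NonDefaultable H lo hi n}.ncard ≤ (looseFaces H).ncard := by
  have hz : (0 : ℝ) ∈ Icc (0 : ℝ) 1 := left_mem_Icc.2 zero_le_one
  have key : ∀ d ∈ faces H, ∃ l u : ℝ, l ∈ Icc (0 : ℝ) 1 ∧ l < u ∧ H l = d ∧
      (∀ x ∈ Icc (0 : ℝ) 1, x ∈ Ico l u ↔ H x = d) := by
    intro d hd
    obtain ⟨x, hx, hxd, hdx⟩ := hd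
    set S : Set ℝ := {y ∈ Icc (0 : ℝ) 1 | H y = d} with hS
    have hSb : BddBelow S := ⟨0, fun y hy => hy.1.1⟩
    have hxS : x ∈ S := ⟨hx, hxd⟩
    have hl : sInf S ∈ Icc (0 : ℝ) 1 :=
      ⟨le_csInf ⟨x, hxS⟩ fun y hy => hy.1.1, (csInf_le hSb hxS).trans hx.2⟩
    -- Right continuity makes the level set contain its infimum.
    have hlS : H (sInf S) = d := by
      refine le_antisymm (hxd ▸ hH.mono hl hx (csInf_le hSb hxS)) ?_
      by_contra hcon
      rw [not_le] at hcon
      have hl1 : sInf S < 1 := by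
        refine lt_of_le_of_ne hl.2 fun h1 => ?_
        have : x = sInf S := le_antisymm (h1 ▸ hx.2) (csInf_le hSb hxS)
        exact hcon.ne (this ▸ hxd)
      have hc := (hH.rightCont _ ⟨hl.1, hl1⟩).eventually (gt_mem_nhds hcon)
      obtain ⟨v, hv, hsub⟩ := mem_nhdsGE_iff_exists_Ico_subset.1 hc
      obtain ⟨y, hyS, hyv⟩ := exists_lt_of_csInf_lt ⟨x, hxS⟩ hv
      have hy' : H y < d := hsub ⟨csInf_le hSb hyS, hyv⟩
      exact hy'.ne hyS.2
    -- The value 2 is a default: if no profit pays more than `d`, the interval extends past 1 and so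
    -- contains 1.
    set T : Set ℝ := insert 2 {y ∈ Icc (0 : ℝ) 1 | d < H y} with hT
    have hTn : T.Nonempty := ⟨2, mem_insert _ _⟩
    have hTlb : ∀ y ∈ Icc (0 : ℝ) 1, H y = d → y ∈ lowerBounds T := by
      rintro y hy hyd z (rfl | ⟨hz1, hz2⟩)
      · linarith [hy.2]
      · by_contra hcon
        exact (hz2.trans_le (hH.mono hz1 hy (not_le.1 hcon).le)).ne hyd.symm
    have hTb : BddBelow T := ⟨x, hTlb x hx hxd⟩
    have hlt : ∀ y ∈ Icc (0 : ℝ) 1, H y = d → y < sInf T := by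
      intro y hy hyd
      refine lt_of_le_of_ne (le_csInf hTn (hTlb y hy hyd)) fun heq => ?_
      have hy1 : y < 1 := by
        refine lt_of_le_of_ne hy.2 fun h1 => ?_
        have hTlb2 : (2 : ℝ) ≤ sInf T := by
          refine le_csInf hTn ?_
          rintro z (rfl | ⟨hz1, hz2⟩)
          · exact le_rfl
          · have := hH.mono hz1 hy (h1 ▸ hz1.2)
            linarith
        linarith
      have hxy : x ≤ y := heq ▸ le_csInf hTn (hTlb x hx hxd)
      -- Finiteness enters here. Just right of `y`, right continuity keeps payments near `d` and
      -- below the profit, so they are face values and must equal `d`; hence `H` cannot exceed `d`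
      -- immediately after `y`.
      have hfin' : ((faces H) \ {d}).Finite := hfin.subset sdiff_subset
      have hnhds : ∀ᶠ e in nhds d, e ∉ (faces H) \ {d} :=
        hfin'.isClosed.isOpen_compl.mem_nhds fun hmem => hmem.2 rfl
      have hev := (hH.rightCont y ⟨hy.1, hy1⟩).eventually
        ((hyd.symm ▸ hnhds : ∀ᶠ e in nhds (H y), e ∉ (faces H) \ {d}).and
          (gt_mem_nhds (show H y < y by rw [hyd]; exact hdx.trans_le hxy)))
      obtain ⟨v, hv, hsub⟩ := mem_nhdsGE_iff_exists_Ico_subset.1 hev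
      obtain ⟨z, hzT, hzv⟩ := exists_lt_of_csInf_lt hTn
        (heq ▸ lt_min hv hy1 : sInf T < min v 1)
      rcases hzT with rfl | ⟨hz1, hz2⟩
      · exact absurd (hzv.trans_le (min_le_right _ _)) (by norm_num)
      · have hyz : y ≤ z := hTlb y hy hyd (mem_insert_of_mem _ ⟨hz1, hz2⟩)
        obtain ⟨h1, h2⟩ := hsub ⟨hyz, hzv.trans_le (min_le_left _ _)⟩
        exact h1 ⟨⟨z, hz1, rfl, h2.trans_le hyz⟩, hz2.ne'⟩
    refine ⟨sInf S, sInf T, hl, hlt _ hl hlS, hlS, fun y hy => ⟨fun hyI => ?_, fun hyd =>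
      ⟨csInf_le hSb ⟨hy, hyd⟩, hlt y hy hyd⟩⟩⟩
    refine le_antisymm ?_ (hlS ▸ hH.mono hl hy hyI.1)
    by_contra hcon
    exact hyI.2.not_ge (csInf_le hTb (mem_insert_of_mem _ ⟨hy, not_le.1 hcon⟩))
  choose! l u hl hlu hHl hIco using key
  obtain ⟨e⟩ : Nonempty (Fin (faces H).ncard ≃ faces H) := by
    have := hfin.to_subtype
    exact ⟨(Finite.equivFinOfCardEq (Nat.card_coe_set_eq (faces H))).symm⟩
  refine ⟨fun i => l (e i), fun i => u (e i), ⟨hH, fun i => hl _ (e i).2, fun i => hlu _ (e i).2,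
    fun i x hx => ?_, fun x hx hout => ?_, fun i j hij => ?_⟩, ?_⟩
  · rw [hHl _ (e i).2]
    exact (hIco _ (e i).2 x hx.2).1 hx.1
  · by_contra hne
    have hd : H x ∈ faces H := ⟨x, hx, rfl, lt_of_le_of_ne (hH.le_self x hx) hne⟩
    refine hout (e.symm ⟨H x, hd⟩) ?_
    simp only [Equiv.apply_symm_apply]
    exact (hIco _ hd x hx).2 rfl
  · simp only [hHl _ (e i).2, hHl _ (e j).2] at hij
    exact e.injective (Subtype.ext hij)
  -- If a face value `d` satisfies `H d = d`, its interval contains the profit `d`, so it is not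
  -- below every profit there.
  · refine Set.ncard_le_ncard_of_injOn (fun i => (e i : ℝ)) (fun i hi => ⟨(e i).2, fun heq => ?_⟩)
      (fun i _ j _ hij => e.injective (Subtype.ext hij)) (hfin.subset fun d hd => hd.1)
    obtain ⟨x, hx, hxd, hdx⟩ := (e i).2
    have hd01 : (e i : ℝ) ∈ Icc (0 : ℝ) 1 := ⟨hxd ▸ hH.nonneg x hx, hdx.le.trans hx.2⟩
    have := hi _ ⟨(hIco _ (e i).2 _ hd01).2 heq, hd01⟩
    rw [hHl _ (e i).2] at this
    exact this.false

theorem Steps.faces_subset {n : ℕ} {s m : ℕ → ℝ} (h : Steps n s m) :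
    faces (stair n s m) ⊆ m '' (Finset.range (n + 1) : Set ℕ) := fun d hd => by
  obtain ⟨i, hi, rfl⟩ := h.exists_eq_of_mem_faces hd
  exact ⟨i, by simpa using Nat.lt_succ_of_le hi, rfl⟩

theorem Steps.finite_faces {n : ℕ} {s m : ℕ → ℝ} (h : Steps n s m) :
    (faces (stair n s m)).Finite :=
  ((Finset.finite_toSet _).image m).subset h.faces_subset

theorem Steps.ncard_faces_le {n : ℕ} {s m : ℕ → ℝ} (h : Steps n s m) :
    (faces (stair n s m)).ncard ≤ n + 1 :=
  (Set.ncard_le_ncard h.faces_subset ((Finset.finite_toSet _).image m)).trans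
    ((Set.ncard_image_le (Finset.finite_toSet _)).trans (by rw [Set.ncard_coe_finset]; simp))

/-! ### Break points of a peaked function -/

theorem lt_of_ordConnected_disjoint {I J : Set ℝ} (hI : I.OrdConnected) (hJ : J.OrdConnected)
    (hIJ : Disjoint I J) {x y : ℝ} (hx : x ∈ I) (hy : y ∈ J) (hxy : x < y) {p q : ℝ} (hp : p ∈ I)
    (hq : q ∈ J) : p < q := by
  by_contra hcon
  rw [not_lt] at hcon
  rcases le_total q x with h | h
  · exact disjoint_left.1 hIJ hx (hJ.out hq hy ⟨h, hxy.le⟩)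
  · exact disjoint_left.1 hIJ (hI.out hx hp ⟨h, hcon⟩) hq

/-- Disjoint intervals are ordered like points chosen in them. After empty ones are dropped and the
points sorted, `u i` and `r (i + 1)` are the infimum and supremum of the `i`-th interval. The
equation `u n = 1` lets the negated function be treated with the same `n`. -/
theorem exists_breaks {N : ℕ} {ρ : ℝ → ℝ} (h : IsPeaked N ρ) :
    ∃ n ≤ N, ∃ r u, Breaks n ρ r u ∧ u n = 1 := by
  classical
  obtain ⟨I, hord, hsub, hdisj, hmono, hanti⟩ := h
  choose! x hx using fun k (hk : (I k).Nonempty) => hk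
  set P : Finset ℝ := (Finset.univ.filter fun k => (I k).Nonempty).image x with hP
  have hPc : P.card ≤ N := (Finset.card_image_le.trans (Finset.card_filter_le _ _)).trans (by simp)
  set e := P.orderEmbOfFin rfl with he
  have hk : ∀ j, ∃ k, (I k).Nonempty ∧ x k = e j := fun j => by
    obtain ⟨k, hk, hkx⟩ := Finset.mem_image.1 (P.orderEmbOfFin_mem rfl j)
    exact ⟨k, (Finset.mem_filter.1 hk).2, hkx⟩
  choose k hkn hkx using hk
  have hmem : ∀ j, e j ∈ I (k j) := fun j => hkx j ▸ hx _ (hkn j)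
  have hbb : ∀ k, BddBelow (I k) := fun k => ⟨0, fun y hy => (hsub k hy).1⟩
  have hba : ∀ k, BddAbove (I k) := fun k => ⟨1, fun y hy => (hsub k hy).2⟩
  have hlt : ∀ {j j'}, j < j' → ∀ {p q}, p ∈ I (k j) → q ∈ I (k j') → p < q := by
    intro j j' hjj p q hp hq
    have hee : e j < e j' := e.strictMono hjj
    have hne : k j ≠ k j' := fun heq => by
      have h1 := hkx j
      rw [heq, hkx j'] at h1
      exact hee.ne h1.symm
    exact lt_of_ordConnected_disjoint (hord _) (hord _) (hdisj hne) (hmem j) (hmem j') hee hp hq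
  have hcover : ∀ k' y, y ∈ I k' → ∃ j, k j = k' := by
    intro k' y hy
    have hxP : x k' ∈ P := Finset.mem_image_of_mem _ (by simpa using ⟨y, hy⟩)
    obtain ⟨j, hj⟩ : ∃ j, e j = x k' := by
      have := P.range_orderEmbOfFin rfl
      have hx' : x k' ∈ (P : Set ℝ) := hxP
      rw [← this] at hx'
      exact hx'
    refine ⟨j, ?_⟩
    by_contra hne
    exact disjoint_left.1 (hdisj hne) (hmem j) (hj ▸ hx _ ⟨y, hy⟩)
  set u : ℕ → ℝ := fun i => if hi : i < P.card then sInf (I (k ⟨i, hi⟩)) else 1 with hu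
  set b : ℕ → ℝ := fun i => if hi : i < P.card then sSup (I (k ⟨i, hi⟩)) else 1 with hb
  set r : ℕ → ℝ := fun i => Nat.casesOn i 0 b with hr
  have hrs : ∀ i, r (i + 1) = b i := fun i => rfl
  refine ⟨P.card, hPc, r, u, ⟨rfl, fun i hi => ?_, fun i => ?_, fun i => ?_, fun i => ?_,
    fun i => ?_⟩, by simp [hu]⟩
  · obtain ⟨i, rfl⟩ := Nat.exists_eq_succ_of_ne_zero (by omega : i ≠ 0)
    rw [Nat.succ_eq_add_one, hrs]
    exact dif_neg (by omega)
  · by_cases hi : i < P.card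
    · simp only [hu, hi, dif_pos]
      refine le_csInf (hkn _) fun q hq => ?_
      cases i with
      | zero => exact (hsub _ hq).1
      | succ i =>
        have hi' : i < P.card := by omega
        rw [hrs]
        simp only [hb, hi', dif_pos]
        exact csSup_le (hkn _) fun p hp => (hlt (Fin.mk_lt_mk.2 i.lt_succ_self) hp hq).le
    · simp only [hu, hi, dif_neg, not_false_eq_true]
      cases i with
      | zero => exact zero_le_one
      | succ i =>
        rw [hrs]
        by_cases hi' : i < P.card
        · simp only [hb, hi', dif_pos]
          exact csSup_le (hkn _) fun p hp => (hsub _ hp).2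
        · simp [hb, hi']
  · rw [hrs]
    by_cases hi : i < P.card
    · simp only [hu, hb, hi, dif_pos]
      exact csInf_le_csSup (hkn _) (hbb _) (hba _)
    · simp [hu, hb, hi]
  · refine hanti _ ordConnected_Ioo fun y hy => ⟨⟨?_, ?_⟩, ?_⟩
    · refine le_trans ?_ hy.1.le
      cases i with
      | zero => exact le_rfl
      | succ i =>
        rw [hrs]
        by_cases hi' : i < P.card
        · simp only [hb, hi', dif_pos]
          exact (hsub _ (hmem _)).1.trans (le_csSup (hba _) (hmem _))
        · simp [hb, hi']
    · refine hy.2.le.trans ?_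
      by_cases hi : i < P.card
      · simp only [hu, hi, dif_pos]
        exact (csInf_le (hbb _) (hmem _)).trans (hsub _ (hmem _)).2
      · simp [hu, hi]
    · rw [mem_iUnion]
      rintro ⟨k', hk'⟩
      obtain ⟨j, rfl⟩ := hcover k' y hk'
      rcases lt_or_ge j.1 i with hji | hji
      · obtain ⟨i, rfl⟩ := Nat.exists_eq_succ_of_ne_zero (by omega : i ≠ 0)
        have hlow := hy.1
        rw [Nat.succ_eq_add_one, hrs] at hlow
        have hyb : y ≤ b i := by
          by_cases hi : i < P.card
          · simp only [hb, hi, dif_pos]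
            rcases (Nat.lt_succ_iff.1 hji).lt_or_eq with hj | hj
            · exact (hlt (show j < ⟨i, hi⟩ from hj) hk' (hmem ⟨i, hi⟩)).le.trans
                (le_csSup (hba _) (hmem _))
            · have : j = ⟨i, hi⟩ := Fin.ext hj
              exact le_csSup (hba _) (this ▸ hk')
          · simp only [hb, hi, dif_neg, not_false_eq_true]
            exact (hsub _ hk').2
        exact hlow.not_ge hyb
      · have hi : i < P.card := hji.trans_lt j.2
        have hup := hy.2
        simp only [hu, hi, dif_pos] at hup
        refine hup.not_ge ?_
        rcases hji.lt_or_eq with hj | hj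
        · exact (csInf_le (hbb _) (hmem _)).trans
            (hlt (show (⟨i, hi⟩ : Fin P.card) < j from hj) (hmem ⟨i, hi⟩) hk').le
        · have : j = ⟨i, hi⟩ := Fin.ext hj.symm
          exact csInf_le (hbb _) (this ▸ hk')
  · rw [hrs]
    by_cases hi : i < P.card
    · simp only [hu, hb, hi, dif_pos]
      refine (hmono (k ⟨i, hi⟩)).mono fun y hy => ?_
      obtain ⟨p, hp, hpy⟩ := exists_lt_of_csInf_lt (hkn _) hy.1
      obtain ⟨q, hq, hyq⟩ := exists_lt_of_lt_csSup (hkn _) hy.2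
      exact (hord _).out hp hq ⟨hpy.le, hyq.le⟩
    · simp only [hu, hb, hi, dif_neg, not_false_eq_true, Ioo_self]
      exact fun _ h => h.elim

/-- The break points for the negated function. -/
theorem Breaks.neg {n : ℕ} {ρ : ℝ → ℝ} {r u : ℕ → ℝ} (h : Breaks n ρ r u) (hn : u n = 1) :
    Breaks n (fun x => -ρ x) (fun i => Nat.casesOn i 0 u) r where
  zero := rfl
  last i hi := by
    obtain ⟨i, rfl⟩ := Nat.exists_eq_succ_of_ne_zero (by omega : i ≠ 0)
    rcases (Nat.lt_succ_iff.1 hi).eq_or_lt with rfl | hlt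
    · exact hn
    · exact le_antisymm (h.last (i + 1) (by omega) ▸ h.le_right i) (h.last i hlt ▸ h.le_left i)
  le_left i := by
    cases i with
    | zero => exact h.zero.symm.le
    | succ i => exact h.le_right i
  le_right i := h.le_left i
  anti i := by
    cases i with
    | zero =>
      rw [h.zero]
      exact fun _ hx => absurd (hx.1.trans hx.2) (lt_irrefl _)
    | succ i => exact (h.mono i).neg
  mono i := (h.anti i).neg

/-! ### Differentiation in effort and the likelihood ratio -/

theorem isSecurity_id : IsSecurity fun x => x where
  mono := monotone_id.monotoneOn _
  rightCont _ _ := continuousWithinAt_id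
  nonneg _ hx := hx.1
  le_self _ _ := le_rfl

theorem isSecurity_standardDebt {d : ℝ} (hd : 0 ≤ d) : IsSecurity (standardDebt d) where
  mono := (monotone_min_const d).monotoneOn _
  rightCont _ _ := continuousWithinAt_id.min continuousWithinAt_const
  nonneg _ hx := le_min hx.1 hd
  le_self _ _ := min_le_left _ _

theorem IsSecurity.abs_le_one {H : ℝ → ℝ} (hH : IsSecurity H) :
    ∀ x ∈ Icc (0 : ℝ) 1, |H x| ≤ 1 := fun x hx => by
  rw [abs_of_nonneg (hH.nonneg x hx)]
  exact (hH.le_self x hx).trans hx.2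

namespace Model

variable {M : Model}

/-- Measurability comes from a limit of difference quotients along efforts in the interval,
integrability from the dominating function. -/
theorem integrableOn_densityDeriv {e : ℝ} (he : e ∈ Icc 0 M.maxEffort) :
    IntegrableOn (fun x => M.densityDeriv x e) (Icc 0 1) := by
  obtain ⟨g, hg, hbound⟩ := M.densityDeriv_dominated
  refine hg.mono' ?_ ?_
  · have : (nhdsWithin e (Icc 0 M.maxEffort \ {e})).NeBot :=
      accPt_principal_iff_nhdsWithin.1 (uniqueDiffOn_Icc M.maxEffort_pos e he).accPt
    classical
    refine aestronglyMeasurable_of_tendsto_ae (nhdsWithin e (Icc 0 M.maxEffort \ {e}))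
      (f := fun t x => if t ∈ Icc 0 M.maxEffort then slope (fun t => M.density x t) e t else 0)
      (fun t => ?_) ?_
    · by_cases ht : t ∈ Icc 0 M.maxEffort
      · simp only [ht, if_true, slope, vsub_eq_sub]
        exact (((M.density_integrable t ht).sub
          (M.density_integrable e he)).const_mul (t - e)⁻¹).aestronglyMeasurable
      · simp only [ht, if_false]
        exact aestronglyMeasurable_const
    · filter_upwards [ae_restrict_mem measurableSet_Icc] with x hx
      refine (hasDerivWithinAt_iff_tendsto_slope.1 (M.density_hasDeriv x hx e he)).congr' ?_
      filter_upwards [self_mem_nhdsWithin] with t ht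
      rw [if_pos ht.1]
  · filter_upwards [ae_restrict_mem measurableSet_Icc] with x hx
    exact hbound x hx e he

theorem continuousOn_integral_density {f : ℝ → ℝ} (hf : MonotoneOn f (Icc 0 1))
    (hf1 : ∀ x ∈ Icc (0 : ℝ) 1, |f x| ≤ 1) :
    ContinuousOn (fun e => ∫ x in (0 : ℝ)..1, f x * M.density x e) (Icc 0 M.maxEffort) := by
  obtain ⟨g, hg, hbound⟩ := M.densityDeriv_dominated
  simp only [intervalIntegral.integral_of_le (zero_le_one' ℝ), ← integral_Icc_eq_integral_Ioc]
  have h0 : (0 : ℝ) ∈ Icc 0 M.maxEffort := left_mem_Icc.2 M.maxEffort_pos.le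
  intro e he
  refine continuousWithinAt_of_dominated
    (bound := fun x => |M.density x 0| + g x * M.maxEffort) ?_ ?_
    ((M.density_integrable 0 h0).abs.add (hg.mul_const _)) ?_
  · filter_upwards [self_mem_nhdsWithin] with t ht
    exact (integrableOn_mul_of_monotoneOn hf (M.density_integrable t ht)).aestronglyMeasurable
  · filter_upwards [self_mem_nhdsWithin] with t ht
    filter_upwards [ae_restrict_mem measurableSet_Icc] with x hx
    -- The mean value inequality from effort 0 bounds all densities by one integrable function.
    have hmv := (convex_Icc 0 M.maxEffort).norm_image_sub_le_of_norm_hasDerivWithin_le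
      (fun t ht => M.density_hasDeriv x hx t ht) (fun t ht => hbound x hx t ht) h0 ht
    have hg0 : 0 ≤ g x := (abs_nonneg _).trans (hbound x hx 0 h0)
    rw [Real.norm_eq_abs, Real.norm_eq_abs, sub_zero, abs_of_nonneg ht.1] at hmv
    have h2 : g x * t ≤ g x * M.maxEffort := mul_le_mul_of_nonneg_left ht.2 hg0
    have h3 := abs_sub_abs_le_abs_sub (M.density x t) (M.density x 0)
    rw [norm_mul, Real.norm_eq_abs, Real.norm_eq_abs]
    have h4 := mul_le_of_le_one_left (abs_nonneg (M.density x t)) (hf1 x hx)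
    linarith
  · filter_upwards [ae_restrict_mem measurableSet_Icc] with x hx
    exact continuousWithinAt_const.mul (M.density_hasDeriv x hx e he).continuousWithinAt

theorem hasDerivAt_integral_density {f : ℝ → ℝ} (hf : MonotoneOn f (Icc 0 1))
    (hf1 : ∀ x ∈ Icc (0 : ℝ) 1, |f x| ≤ 1) {e : ℝ} (he : e ∈ Ioo 0 M.maxEffort) :
    HasDerivAt (fun t => ∫ x in (0 : ℝ)..1, f x * M.density x t)
      (∫ x in (0 : ℝ)..1, f x * M.densityDeriv x e) e := by
  obtain ⟨g, hg, hbound⟩ := M.densityDeriv_dominated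
  simp only [intervalIntegral.integral_of_le (zero_le_one' ℝ), ← integral_Icc_eq_integral_Ioc]
  have heI : e ∈ Icc 0 M.maxEffort := Ioo_subset_Icc_self he
  have hnhds : Ioo 0 M.maxEffort ∈ nhds e := Ioo_mem_nhds he.1 he.2
  refine (hasDerivAt_integral_of_dominated_loc_of_deriv_le (bound := g)
    (F := fun t x => f x * M.density x t) (F' := fun t x => f x * M.densityDeriv x t)
    hnhds ?_ (integrableOn_mul_of_monotoneOn hf (M.density_integrable e heI))
    (integrableOn_mul_of_monotoneOn hf (integrableOn_densityDeriv heI)).aestronglyMeasurable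
    ?_ hg ?_).2
  · filter_upwards [hnhds] with t ht
    exact (integrableOn_mul_of_monotoneOn hf
      (M.density_integrable t (Ioo_subset_Icc_self ht))).aestronglyMeasurable
  · filter_upwards [ae_restrict_mem measurableSet_Icc] with x hx t ht
    rw [norm_mul, Real.norm_eq_abs, Real.norm_eq_abs]
    exact (mul_le_of_le_one_left (abs_nonneg _) (hf1 x hx)).trans
      (hbound x hx t (Ioo_subset_Icc_self ht))
  · filter_upwards [ae_restrict_mem measurableSet_Icc] with x hx t ht
    exact ((M.density_hasDeriv x hx t (Ioo_subset_Icc_self ht)).hasDerivAt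
      (Icc_mem_nhds ht.1 ht.2)).const_mul _

theorem integral_densityDeriv_eq_zero {e : ℝ} (he : e ∈ Ioo 0 M.maxEffort) :
    ∫ x in (0 : ℝ)..1, M.densityDeriv x e = 0 := by
  have h := hasDerivAt_integral_density (f := fun _ => 1) monotoneOn_const (by simp) he
  simp only [one_mul] at h
  refine h.unique ((hasDerivAt_const e (1 : ℝ)).congr_of_eventuallyEq ?_)
  filter_upwards [Ioo_mem_nhds he.1 he.2] with t ht
  exact M.density_integral t (Ioo_subset_Icc_self ht)

/-- The difference quotient divided by the density is `(t - e)⁻¹` times the likelihood ratio minus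
1. For `t > e` it is nondecreasing in the profit, and so is its limit. -/
theorem MLRP.monotoneOn_ratio (h : M.MLRP) {e : ℝ} (he : e ∈ Ioo 0 M.maxEffort) :
    MonotoneOn (fun x => M.densityDeriv x e / M.density x e) (Icc 0 1) := by
  have heI : e ∈ Icc 0 M.maxEffort := Ioo_subset_Icc_self he
  have hlim : ∀ x ∈ Icc (0 : ℝ) 1, Filter.Tendsto
      (fun t => slope (fun t => M.density x t) e t / M.density x e)
      (nhdsWithin e (Ioc e M.maxEffort)) (nhds (M.densityDeriv x e / M.density x e)) := by
    intro x hx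
    have := (M.density_hasDeriv x hx e heI).mono (Ioc_subset_Icc_self.trans
      (Icc_subset_Icc_left he.1.le) : Ioc e M.maxEffort ⊆ _)
    exact ((hasDerivWithinAt_iff_tendsto_slope' (by simp)).1 this).div_const _
  have : (nhdsWithin e (Ioc e M.maxEffort)).NeBot := left_nhdsWithin_Ioc_neBot he.2
  intro x hx y hy hxy
  refine le_of_tendsto_of_tendsto (hlim x hx) (hlim y hy) ?_
  filter_upwards [self_mem_nhdsWithin] with t ht
  have hρ := h e heI t ⟨he.1.le.trans ht.1.le, ht.2⟩ ht.1.le hx hy hxy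
  have hx0 := M.density_pos x hx e heI
  have hy0 := M.density_pos y hy e heI
  have key : ∀ z, 0 < M.density z e → slope (fun t => M.density z t) e t / M.density z e
      = (t - e)⁻¹ * (M.density z t / M.density z e - 1) := fun z hz => by
    rw [slope_def_field]
    field_simp
  rw [key x hx0, key y hy0]
  exact mul_le_mul_of_nonneg_left (by linarith) (inv_nonneg.2 (sub_nonneg.2 ht.1.le))

/-- Under the monotone likelihood ratio property, effort raises the expectation of a payment that
crosses its mean once from below. -/
theorem MLRP.integral_mul_densityDeriv_nonneg (h : M.MLRP) {e : ℝ} (he : e ∈ Ioo 0 M.maxEffort)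
    {D : ℝ → ℝ} {κ : ℝ}
    (hφ : IntegrableOn (fun x => D x * M.density x e) (Icc 0 1))
    (hψ : IntegrableOn (fun x => D x * M.densityDeriv x e) (Icc 0 1))
    (hκ : ∫ x in (0 : ℝ)..1, D x * M.density x e = κ)
    (hcr : ∀ x ∈ Ioo (0 : ℝ) 1, ∀ y ∈ Ioo (0 : ℝ) 1, x ≤ y → κ < D x → κ ≤ D y) :
    0 ≤ ∫ x in (0 : ℝ)..1, D x * M.densityDeriv x e := by
  have heI : e ∈ Icc 0 M.maxEffort := Ioo_subset_Icc_self he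
  have hz : (0 : ℝ) ∈ Icc (0 : ℝ) 1 := left_mem_Icc.2 zero_le_one
  have ho : (1 : ℝ) ∈ Icc (0 : ℝ) 1 := right_mem_Icc.2 zero_le_one
  have i1 := intervalIntegrable_sub hφ hz ho
  have i2 := intervalIntegrable_sub hψ hz ho
  have i3 : IntervalIntegrable (fun x => κ * M.density x e) volume 0 1 :=
    (intervalIntegrable_sub (M.density_integrable e heI) hz ho).const_mul κ
  have i4 : IntervalIntegrable (fun x => κ * M.densityDeriv x e) volume 0 1 :=
    (intervalIntegrable_sub (integrableOn_densityDeriv heI) hz ho).const_mul κ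
  -- Subtracting the mean κ leaves the integral against the effort derivative unchanged, as that
  -- derivative integrates to 0.
  obtain ⟨t, ht1, ht2⟩ := exists_crossing (a := 0) (b := 1) (f := fun x => D x - κ)
    fun x hx y hy hxy hpos => sub_nonneg.2 (hcr x hx y hy hxy (sub_pos.1 hpos))
  have key := integral_mul_nonneg_of_crossing (t := t) zero_le_one (D := fun x => D x - κ)
    (φ := fun x => M.density x e) (ψ := fun x => M.densityDeriv x e)
    (fun x hx => M.density_pos x (Ioo_subset_Icc_self hx) e heI)
    ((h.monotoneOn_ratio he).mono Ioo_subset_Icc_self) ht1 ht2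
    (by simpa only [sub_mul] using i1.sub i3) (by simpa only [sub_mul] using i2.sub i4)
    (by
      simp only [sub_mul]
      rw [intervalIntegral.integral_sub i1 i3, intervalIntegral.integral_const_mul, hκ,
        M.density_integral e heI, mul_one, sub_self])
  simp only [sub_mul] at key
  rwa [intervalIntegral.integral_sub i2 i4, intervalIntegral.integral_const_mul,
    integral_densityDeriv_eq_zero he, mul_zero, sub_zero] at key

/-! ### Surplus, optimality and the two halves of the theorem -/

theorem requiredReturn_pos : 0 < M.requiredReturn :=
  mul_pos (by linarith [M.rate_pos]) M.investment_pos

variable (M) in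
/-- The total expected payoff of entrepreneur and investor. -/
noncomputable def surplus (e : ℝ) : ℝ := (∫ x in (0 : ℝ)..1, x * M.density x e) - M.cost e

theorem continuousOn_cost : ContinuousOn M.cost (Icc 0 M.maxEffort) := fun e he =>
  (M.cost_hasDeriv e he).continuousWithinAt

theorem continuousOn_surplus : ContinuousOn M.surplus (Icc 0 M.maxEffort) :=
  (continuousOn_integral_density isSecurity_id.mono isSecurity_id.abs_le_one).sub
    continuousOn_cost

theorem integral_sub_mul {H w : ℝ → ℝ} (hH : IsSecurity H) (hw : IntegrableOn w (Icc 0 1)) :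
    ∫ x in (0 : ℝ)..1, (x - H x) * w x
      = (∫ x in (0 : ℝ)..1, x * w x) - ∫ x in (0 : ℝ)..1, H x * w x := by
  have hz : (0 : ℝ) ∈ Icc (0 : ℝ) 1 := left_mem_Icc.2 zero_le_one
  have ho : (1 : ℝ) ∈ Icc (0 : ℝ) 1 := right_mem_Icc.2 zero_le_one
  simp only [sub_mul]
  exact intervalIntegral.integral_sub
    (intervalIntegrable_sub (isSecurity_id.integrableOn_mul hw) hz ho)
    (intervalIntegrable_sub (hH.integrableOn_mul hw) hz ho)

theorem payoff_eq {H : ℝ → ℝ} (hH : IsSecurity H) {e : ℝ} (he : e ∈ Icc 0 M.maxEffort) :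
    M.payoff H e = M.surplus e - M.investorReturn H e := by
  rw [payoff, surplus, investorReturn, integral_sub_mul hH (M.density_integrable e he)]
  ring

/-- A feasible pair is optimal if it maximizes the surplus and leaves the investor the required
return. -/
theorem optimal_of_isMaxOn {IC : (ℝ → ℝ) → ℝ → Prop} {H : ℝ → ℝ} {e : ℝ} (hH : IsSecurity H)
    (he : e ∈ Icc 0 M.maxEffort) (hIC : IC H e) (hR : M.investorReturn H e = M.requiredReturn)
    (hmax : IsMaxOn M.surplus (Icc 0 M.maxEffort) e) : M.Optimal IC H e := by
  refine ⟨⟨hH, he, hIC, hR.ge⟩, fun G t hG => ?_⟩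
  rw [payoff_eq hG.security hG.effort_mem, payoff_eq hH he, hR]
  linarith [hG.participation, isMaxOn_iff.1 hmax t hG.effort_mem]

theorem RequiredReturnInterior.exists_security (h : M.RequiredReturnInterior) {e : ℝ}
    (he : e ∈ Icc 0 M.maxEffort) :
    ∃ H, IsSecurity H ∧ M.FirstOrder H e ∧ M.investorReturn H e = M.requiredReturn := by
  have := interior_subset (h e he)
  exact this

theorem exists_contingentDebt_solves (hInt : M.RequiredReturnInterior) {N : ℕ}
    (hpeak : ∀ e ∈ Icc 0 M.maxEffort,
      IsAtMostPeaked N fun x => M.densityDeriv x e / M.density x e) :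
    ∃ H : ℝ → ℝ, M.SolvesProblem H ∧ ∃ k ≤ N + 1, ∃ lo hi : Fin k → ℝ,
      IsContingentDebt H lo hi ∧ {n | NonDefaultable H lo hi n}.ncard ≤ 2 := by
  obtain ⟨e, he, hmax⟩ := isCompact_Icc.exists_isMaxOn
    (nonempty_Icc.2 M.maxEffort_pos.le) M.continuousOn_surplus
  obtain ⟨G, hG, hfoc, hret⟩ := hInt.exists_security he
  obtain ⟨N', hN', hp⟩ := hpeak e he
  obtain ⟨n, hn, r, u, hB, hun⟩ := exists_breaks hp
  have hφi := M.density_integrable e he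
  have hψi := integrableOn_densityDeriv he
  have hφ : ∀ x ∈ Icc (0 : ℝ) 1, 0 < M.density x e := fun x hx => M.density_pos x hx e he
  obtain ⟨s₁, m₁, h₁, hφ₁, hψ₁⟩ := exists_stair_ge hG hφi hψi hφ hB
  -- Matching against the negated derivative bounds the integral from the other side.
  have hB' := hB.neg hun
  simp only [← neg_div] at hB'
  obtain ⟨s₀, m₀, h₀, hφ₀, hψ₀⟩ := exists_stair_ge hG hφi hψi.neg hφ hB'
  simp only [Pi.neg_apply, mul_neg, intervalIntegral.integral_neg, neg_le_neg_iff] at hψ₀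
  obtain ⟨s, m, h, hφs, hψs⟩ := exists_stair_eq h₀ h₁ hφi hψi hφ hφ₀ hφ₁ hψ₀ hψ₁
  obtain ⟨q, hq, hφq, hψq, hcard⟩ := exists_stair_ncard_looseFaces_le h hφi hψi
  obtain ⟨lo, hi, hcd, hnd⟩ := hq.isSecurity.exists_isContingentDebt hq.finite_faces
  refine ⟨stair n s q, ⟨e, optimal_of_isMaxOn hq.isSecurity he ?_ ?_ hmax⟩, _,
    hq.ncard_faces_le.trans (by omega), lo, hi, hcd, hnd.trans hcard⟩
  · rw [FirstOrder, integral_sub_mul hq.isSecurity hψi, hψq, hψs, ← integral_sub_mul hG hψi]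
    exact hfoc
  · rw [investorReturn, hφq, hφs]
    exact hret

/-- Face value 0 pays nothing and face value 1 the whole profit, at least as much as `G`; the return
is continuous in between. -/
theorem exists_standardDebt_return_eq {e : ℝ} (he : e ∈ Icc 0 M.maxEffort) {G : ℝ → ℝ}
    (hG : IsSecurity G) (hret : M.investorReturn G e = M.requiredReturn) :
    ∃ d, 0 < d ∧ M.investorReturn (standardDebt d) e = M.requiredReturn := by
  have hz : (0 : ℝ) ∈ Icc (0 : ℝ) 1 := left_mem_Icc.2 zero_le_one
  have ho : (1 : ℝ) ∈ Icc (0 : ℝ) 1 := right_mem_Icc.2 zero_le_one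
  have hφi := M.density_integrable e he
  have h0 : M.investorReturn (standardDebt 0) e = 0 := by
    rw [investorReturn, integral_eq_of_eqOn_Ioo (g := fun _ => 0) zero_le_one (fun x hx => by
      rw [standardDebt, min_eq_right hx.1.le, zero_mul])]
    simp
  have h1 : M.requiredReturn ≤ M.investorReturn (standardDebt 1) e := by
    rw [← hret]
    refine integral_le_integral_of_le_Ioo zero_le_one
      (fun x hx => (M.density_pos x (Ioo_subset_Icc_self hx) e he).le)
      (fun x hx => ?_) (intervalIntegrable_sub (hG.integrableOn_mul hφi) hz ho)
      (intervalIntegrable_sub (integrableOn_min_mul hφi 1) hz ho)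
    rw [standardDebt, min_eq_left hx.2.le]
    exact hG.le_self x (Ioo_subset_Icc_self hx)
  have hcont : Continuous fun d => M.investorReturn (standardDebt d) e :=
    continuous_integral_min_mul hφi hz ho zero_le_one
  obtain ⟨d, hd, hdR⟩ := intermediate_value_Icc (zero_le_one' ℝ) hcont.continuousOn
    ⟨h0.trans_le M.requiredReturn_pos.le, h1⟩
  refine ⟨d, lt_of_le_of_ne hd.1 ?_, hdR⟩
  rintro rfl
  exact M.requiredReturn_pos.ne (h0.symm.trans hdR)

theorem MLRP.exists_standardDebt_solves (h : M.MLRP) (hInt : M.RequiredReturnInterior) :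
    ∃ d : ℝ, 0 < d ∧ M.SolvesBestResponseProblem (standardDebt d) ∧
      (M.FirstOrderNecessary → M.SolvesProblem (standardDebt d)) := by
  have htop : M.maxEffort ∈ Icc 0 M.maxEffort := right_mem_Icc.2 M.maxEffort_pos.le
  obtain ⟨G, hG, -, hret⟩ := hInt.exists_security htop
  obtain ⟨d, hd, hdR⟩ := exists_standardDebt_return_eq htop hG hret
  have hD : IsSecurity (standardDebt d) := isSecurity_standardDebt hd.le
  have hcontD := M.continuousOn_integral_density hD.mono hD.abs_le_one
  have hret_mono : MonotoneOn (M.investorReturn (standardDebt d)) (Icc 0 M.maxEffort) := by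
    refine monotoneOn_of_hasDerivWithinAt_nonneg (convex_Icc _ _)
      (f' := fun e => ∫ x in (0 : ℝ)..1, standardDebt d x * M.densityDeriv x e) hcontD
      (fun e he => ?_) (fun e he => ?_)
    · rw [interior_Icc] at he
      exact (hasDerivAt_integral_density hD.mono hD.abs_le_one he).hasDerivWithinAt
    · rw [interior_Icc] at he
      have heI := Ioo_subset_Icc_self he
      refine h.integral_mul_densityDeriv_nonneg he (hD.integrableOn_mul (M.density_integrable e heI))
        (hD.integrableOn_mul (integrableOn_densityDeriv heI)) rfl fun x hx y hy hxy hlt => ?_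
      exact hlt.le.trans (hD.mono (Ioo_subset_Icc_self hx) (Ioo_subset_Icc_self hy) hxy)
  have hpay_mono : MonotoneOn (fun e => M.surplus e - M.investorReturn (standardDebt d) e)
      (Icc 0 M.maxEffort) := by
    refine monotoneOn_of_hasDerivWithinAt_nonneg (convex_Icc _ _)
      (f' := fun e => (∫ x in (0 : ℝ)..1, x * M.densityDeriv x e) - M.costDeriv e
        - ∫ x in (0 : ℝ)..1, standardDebt d x * M.densityDeriv x e)
      (continuousOn_surplus.sub hcontD) (fun e he => ?_) (fun e he => ?_)
    · rw [interior_Icc] at he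
      exact (((hasDerivAt_integral_density isSecurity_id.mono isSecurity_id.abs_le_one he).sub
        ((M.cost_hasDeriv e (Ioo_subset_Icc_self he)).hasDerivAt
          (Icc_mem_nhds he.1 he.2))).sub
        (hasDerivAt_integral_density hD.mono hD.abs_le_one he)).hasDerivWithinAt
    · rw [interior_Icc] at he
      have heI := Ioo_subset_Icc_self he
      -- The comparison security changes with the effort; its marginal payoff to the entrepreneur is
      -- zero by the first-order condition.
      obtain ⟨K, hK, hfoc, hKret⟩ := hInt.exists_security heI
      have hφi := M.density_integrable e heI
      have hψi := integrableOn_densityDeriv heI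
      have hz : (0 : ℝ) ∈ Icc (0 : ℝ) 1 := left_mem_Icc.2 zero_le_one
      have ho : (1 : ℝ) ∈ Icc (0 : ℝ) 1 := right_mem_Icc.2 zero_le_one
      have hint : ∀ {w : ℝ → ℝ}, IntegrableOn w (Icc 0 1) →
          IntegrableOn (fun x => (K x - standardDebt d x) * w x) (Icc 0 1) ∧
          ∫ x in (0 : ℝ)..1, (K x - standardDebt d x) * w x
            = (∫ x in (0 : ℝ)..1, K x * w x) - ∫ x in (0 : ℝ)..1, standardDebt d x * w x := by
        intro w hw
        simp only [sub_mul]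
        exact ⟨(hK.integrableOn_mul hw).sub (hD.integrableOn_mul hw),
          intervalIntegral.integral_sub (intervalIntegrable_sub (hK.integrableOn_mul hw) hz ho)
            (intervalIntegrable_sub (hD.integrableOn_mul hw) hz ho)⟩
      have hle : M.investorReturn (standardDebt d) e ≤ M.investorReturn K e := by
        rw [hKret, ← hdR]
        exact hret_mono heI htop heI.2
      have key := h.integral_mul_densityDeriv_nonneg he (hint hφi).1 (hint hψi).1 (hint hφi).2
        (fun x hx y hy hxy hlt => by
          -- The mean is nonnegative by `hle`, so above it `K` strictly exceeds debt. As `K x ≤ x`,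
          -- debt then pays `d`, and further right `K` only grows.
          have hpos : 0 < K x - standardDebt d x := (sub_nonneg.2 hle).trans_lt hlt
          have hKx := hK.le_self x (Ioo_subset_Icc_self hx)
          have hdx : standardDebt d x = d :=
            (min_choice x d).resolve_left fun heq => by
              rw [standardDebt, heq] at hpos
              linarith
          have hdy : standardDebt d y ≤ d := min_le_right _ _
          have hKy := hK.mono (Ioo_subset_Icc_self hx) (Ioo_subset_Icc_self hy) hxy
          linarith)
      rw [(hint hψi).2] at key
      rw [FirstOrder, integral_sub_mul hK hψi] at hfoc
      linarith
  have hbest : M.BestResponse (standardDebt d) M.maxEffort :=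
    ⟨htop, fun t ht => by
      rw [payoff_eq hD ht, payoff_eq hD htop]
      exact hpay_mono ht htop ht.2⟩
  have hmax : IsMaxOn M.surplus (Icc 0 M.maxEffort) M.maxEffort := isMaxOn_iff.2 fun t ht => by
    have h1 := hpay_mono ht htop ht.2
    have h2 := hret_mono ht htop ht.2
    simp only at h1
    linarith
  exact ⟨d, hd, ⟨_, optimal_of_isMaxOn hD htop hbest hdR hmax⟩, fun hnec =>
    ⟨_, optimal_of_isMaxOn hD htop (hnec _ _ hD hbest) hdR hmax⟩⟩

end Model

end SecurityDesign

theorem proposition4 (M : SecurityDesign.Model) (hInt : M.RequiredReturnInterior) :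
    (∀ N : ℕ,
      (∀ e ∈ Set.Icc 0 M.maxEffort,
        SecurityDesign.IsAtMostPeaked N (fun x => M.densityDeriv x e / M.density x e)) →
      ∃ H : ℝ → ℝ, M.SolvesProblem H ∧
        ∃ k ≤ N + 1, ∃ lo hi : Fin k → ℝ,
          SecurityDesign.IsContingentDebt H lo hi ∧
          {n | SecurityDesign.NonDefaultable H lo hi n}.ncard ≤ 2) ∧
    (M.MLRP →
      ∃ d : ℝ, 0 < d ∧ M.SolvesBestResponseProblem (SecurityDesign.standardDebt d) ∧
        (M.FirstOrderNecessary → M.SolvesProblem (SecurityDesign.standardDebt d))) :=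
  ⟨fun _ hpeak => SecurityDesign.Model.exists_contingentDebt_solves hInt hpeak,
    fun h => h.exists_standardDebt_solves hInt⟩
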